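/- **Setting.** Let $\mathcal M$ be a $d$-dimensional closed (compact, without boundary), connected smooth Riemannian manifold with volume measure $\mathrm dV$, let $\mathsf K\ge 2$, and for $1\le \ell\le \mathsf K$ let $\iota_\ell:\mathcal M\to\mathbb R^{p_\ell}$ be a smooth embedding (a diffeomorphism onto its image). Put $\vartheta_{ji}=\iota_j\circ\iota_i^{-1}:\iota_i(\mathcal M)\to\iota_j(\mathcal M)$. Let $X$ be an $\mathcal M$-valued random variable whose law $\mathbb P$ has a density $\varrho$ with respect to $\mathrm dV$ with $\delta_0\le\varrho\le\delta_0^{-1}$ on $\mathcal M$, for some $0<\delta_0<1$. Write $X_\ell=\iota_\ell(X)$, and $\mathbb P_\ell$ for its law on $\iota_\ell(\mathcal M)$. Let $x_1,x_2,\ldots$ be i.i.d. copies of $X$, and $\mathbf x_i^\ell=\iota_\ell(x_i)$. Let $K:[0,\infty)\to[0,\infty)$ be bounded, $C^3$ on $(0,\infty)$, with $K(0)>0$, $K(1)>0$ and $\int_{\mathbb R^d}K(\|v\|)\,\mathrm dv=1$. Let $f_j\in C^4(\iota_j(\mathcal M))$ for $1\le j\le\mathsf K$, and $\mathbf f=(f_1,\dots,f_{\mathsf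 K})$. For each $n$ let $\epsilon_1,\dots,\epsilon_{\mathsf K}>0$ be deterministic bandwidths (depending on $n$), and write $K_{\epsilon_i}(x,w)=K(\|x-w\|_2^2/\epsilon_i)$. *Transition matrix.* Let $\check{\mathbf K}^\ell\in\mathbb R^{n\times n}$ have entries $\check{\mathbf K}^\ell(i,j)=K_{\epsilon_\ell}(\mathbf x_i^\ell,\mathbf x_j^\ell)$, let $\check{\mathcal K}\in\mathbb R^{n\mathsf K\times n\mathsf K}$ be the block matrix with zero diagonal blocks and with $(\ell_1,\ell_2)$ block $\check{\mathbf K}^{\ell_1}\check{\mathbf K}^{\ell_2}$ for $\ell_1\ne\ell_2$, let $\check{\mathcal D}$ be the diagonal matrix of the row sums of $\check{\mathcal K}$, and $\check{\mathcal A}=\check{\mathcal D}^{-1}\check{\mathcal K}$. Let $\boldsymbol f\in\mathbb R^{n\mathsf K}$ be the block vector whose $\ell$-th block is $(f_\ell(\mathbf x_1^\ell),\dots,f_\ell(\mathbf x_n^\ell))$. *Limiting operator.* For $x\in\iota_i(\mathcal M)$ and $y\in\iota_j(\mathcal M)$ put $\widetilde K_{ij}(x,y)=\int_{\iota_i(\mathcal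 M)}K_{\epsilon_i}(x,w)\,K_{\epsilon_j}(\vartheta_{ji}(w),y)\,\mathrm d\mathbb P_i(w)$ and $$[\Omega\mathbf f]_i(x)=\sum_{j\ne i}\omega_{ij}f_j(x),\qquad \omega_{ij}f_j(x)=\frac{\mathbb E[\widetilde K_{ij}(x,X_j)f_j(X_j)]}{\sum_{k\ne i}\mathbb E[\widetilde K_{ik}(x,X_k)]}.$$ *Stochastic domination.* For families $\mathsf X^{(n)}(u),\mathsf Y^{(n)}(u)\ge 0$ of random variables with $u\in\mathsf U^{(n)}$, $\mathsf X=\mathrm O_\prec(\mathsf Y)$ uniformly in $u$ means: for all $\upsilon,D>0$ there is $n_0$ with $\sup_{u}\Pr(\mathsf X^{(n)}(u)>n^{\upsilon}\mathsf Y^{(n)}(u))\le n^{-D}$ for all $n\ge n_0$. **Theorem (variance analysis).** In this setting suppose that $\epsilon_i\asymp\epsilon_j$ for all $i,j$, and that, as $n\to\infty$, $$\epsilon_i\to0\quad(1\le i\le\mathsf K)\qquad\text{and}\qquad \frac{\sqrt{\log n}}{\sqrt n\,\epsilon_i^{d/4}\epsilon_j^{d/4}}\to0\quad(i\ne j).$$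 Then, uniformly in $1\le s\le n\mathsf K$, with $\ell=\lfloor (s-1)/n\rfloor+1$ and $s'=s-(\ell-1)n$, $$[\check{\mathcal A}\boldsymbol f](s)=[\Omega\mathbf f]_\ell(\mathbf x_{s'}^\ell)+\mathrm O_\prec\Big(\sum_{j\ne\ell}\frac{1}{\sqrt n\,\epsilon_\ell^{d/4}\epsilon_j^{d/2}}\Big).$$ -/

import Mathlib

open MeasureTheory ProbabilityTheory Filter Asymptotics
open scoped Manifold ContDiff Topology

noncomputable section

namespace GrabMDM

/-! ### Riemannian volume -/

section Volume

variable {d : ℕ} {M : Type*} [TopologicalSpace M] [ChartedSpace (EuclideanSpace ℝ (Fin d)) M]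
  [IsManifold (𝓡 d) ∞ M]

/-- The Gram matrix `G = (g(∂ₐ, ∂_b))` of a Riemannian metric `g`, in the coordinates of the
preferred chart at `c`, at the point with coordinates `u`. -/
def chartGram
    (g : Bundle.ContMDiffRiemannianMetric (𝓡 d) ∞ (EuclideanSpace ℝ (Fin d))
      (fun x : M => TangentSpace (𝓡 d) x))
    (c : M) (u : EuclideanSpace ℝ (Fin d)) : Matrix (Fin d) (Fin d) ℝ :=
  Matrix.of fun a b =>
    g.inner ((extChartAt (𝓡 d) c).symm u)
      (mfderiv 𝓘(ℝ, EuclideanSpace ℝ (Fin d)) (𝓡 d) (extChartAt (𝓡 d) c).symm u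
        (EuclideanSpace.single a (1 : ℝ) : EuclideanSpace ℝ (Fin d)))
      (mfderiv 𝓘(ℝ, EuclideanSpace ℝ (Fin d)) (𝓡 d) (extChartAt (𝓡 d) c).symm u
        (EuclideanSpace.single b (1 : ℝ) : EuclideanSpace ℝ (Fin d)))

/-- The measure `√(det G) du` of the preferred chart at `c`, transported to `M`. It is carried by
the domain of that chart. -/
def chartVolume [MeasurableSpace M]
    (g : Bundle.ContMDiffRiemannianMetric (𝓡 d) ∞ (EuclideanSpace ℝ (Fin d))
      (fun x : M => TangentSpace (𝓡 d) x)) (c : M) : Measure M :=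
  (((volume : Measure (EuclideanSpace ℝ (Fin d))).restrict
      (extChartAt (𝓡 d) c).target).withDensity
        fun u => ENNReal.ofReal (Real.sqrt (chartGram g c u).det)).map
    (extChartAt (𝓡 d) c).symm

/-- The Riemannian volume measure `dV`. By the change of variables formula the chart measures agree
on overlaps, that is, each of them is the restriction of one measure `dV` to the domain of a chart;
`dV` is then the least measure that dominates all of them. -/
def riemannianVolume [MeasurableSpace M]
    (g : Bundle.ContMDiffRiemannianMetric (𝓡 d) ∞ (EuclideanSpace ℝ (Fin d))
      (fun x : M => TangentSpace (𝓡 d) x)) : Measure M :=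
  ⨆ c : M, chartVolume g c

end Volume

/-! ### Stochastic domination -/

/-- `X ≺ Y`, uniformly in the parameter `u ∈ U n`. -/
def StochDominated {S : Type*} [MeasurableSpace S] (P : Measure S) {U : ℕ → Type*}
    (X Y : ∀ n : ℕ, U n → S → ℝ) : Prop :=
  ∀ υ : ℝ, 0 < υ → ∀ D : ℝ, 0 < D → ∃ n₀ : ℕ, ∀ n : ℕ, n₀ ≤ n → ∀ u : U n,
    P.real {a | X n u a > (n : ℝ) ^ υ * Y n u a} ≤ (n : ℝ) ^ (-D)

/-! ### The kernel -/

/-- The assumptions on the kernel function `K : [0, ∞) → [0, ∞)`, in latent dimension `d`; only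
the values of `K` on `[0, ∞)` matter. -/
structure IsAdmissibleKernel (d : ℕ) (K : ℝ → ℝ) : Prop where
  nonneg : ∀ r : ℝ, 0 ≤ r → 0 ≤ K r
  contDiffOn : ContDiffOn ℝ 3 K (Set.Ioi 0)
  bounded : ∃ B : ℝ, ∀ r : ℝ, 0 ≤ r → K r ≤ B
  zero_pos : 0 < K 0
  one_pos : 0 < K 1
  normalized : ∫ v : EuclideanSpace ℝ (Fin d), K ‖v‖ = 1

/-- `K_ε(x, w) = K(‖x - w‖² / ε)`. -/
def kernelAt {E : Type*} [NormedAddCommGroup E] (K : ℝ → ℝ) (ε : ℝ) (x w : E) : ℝ :=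
  K (‖x - w‖ ^ 2 / ε)

/-! ### The transition matrix -/

section Matrices

variable {κ n : ℕ}

/-- The `n × n` kernel matrix of a point cloud. -/
def kernelMatrix {E : Type*} [NormedAddCommGroup E] (K : ℝ → ℝ) (ε : ℝ) (x : Fin n → E) :
    Matrix (Fin n) (Fin n) ℝ :=
  Matrix.of fun i j => kernelAt K ε (x i) (x j)

/-- The `nκ × nκ` block matrix with zero diagonal blocks and `(ℓ₁, ℓ₂)` block `A ℓ₁ * A ℓ₂` for
`ℓ₁ ≠ ℓ₂`. The index `(ℓ, s')` is the `s'`-th index of the `ℓ`-th block. -/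
def blockKernel (A : Fin κ → Matrix (Fin n) (Fin n) ℝ) :
    Matrix (Fin κ × Fin n) (Fin κ × Fin n) ℝ :=
  Matrix.of fun a b => if a.1 = b.1 then 0 else (A a.1 * A b.1) a.2 b.2

/-- The diagonal degree matrix of `𝒦`. -/
def degreeMatrix (𝒦 : Matrix (Fin κ × Fin n) (Fin κ × Fin n) ℝ) :
    Matrix (Fin κ × Fin n) (Fin κ × Fin n) ℝ :=
  Matrix.diagonal fun a => ∑ b, 𝒦 a b

/-- The transition matrix `𝒟⁻¹ 𝒦`. -/
def transitionMatrix (A : Fin κ → Matrix (Fin n) (Fin n) ℝ) :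
    Matrix (Fin κ × Fin n) (Fin κ × Fin n) ℝ :=
  (degreeMatrix (blockKernel A))⁻¹ * blockKernel A

end Matrices

/-! ### The limiting operator -/

section Operators

variable {M : Type*} {κ : ℕ} {p : Fin κ → ℕ}

/-- The observed image `ι_ℓ(M)` in the `ℓ`-th view. -/
abbrev View (ι : ∀ ℓ : Fin κ, M → EuclideanSpace ℝ (Fin (p ℓ))) (ℓ : Fin κ) : Type :=
  Set.range (ι ℓ)

/-- `ι_ℓ` as a map onto `ι_ℓ(M)`. -/
def toView (ι : ∀ ℓ : Fin κ, M → EuclideanSpace ℝ (Fin (p ℓ))) (ℓ : Fin κ) (z : M) : View ι ℓ :=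
  ⟨ι ℓ z, Set.mem_range_self z⟩

/-- `ϑ_{ji} = ι_j ∘ ι_i⁻¹ : ι_i(M) → ι_j(M)`, for injective `ι_i`. -/
def transfer (ι : ∀ ℓ : Fin κ, M → EuclideanSpace ℝ (Fin (p ℓ))) (j i : Fin κ)
    (y : View ι i) : View ι j :=
  toView ι j (Set.rangeSplitting (ι i) y)

variable [MeasurableSpace M]

/-- The law `ℙ_ℓ` of `X_ℓ = ι_ℓ ∘ X` on `ι_ℓ(M)`, where `μ` is the law of `X`. -/
def viewLaw (ι : ∀ ℓ : Fin κ, M → EuclideanSpace ℝ (Fin (p ℓ))) (μ : Measure M) (ℓ : Fin κ) :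
    Measure (View ι ℓ) :=
  μ.map (toView ι ℓ)

/-- The transfer kernel
`K̃_{ij}(x, y) = ∫ K_{ε_i}(x, w) K_{ε_j}(ϑ_{ji}(w), y) dℙ_i(w)`. -/
def transferKernel (K : ℝ → ℝ) (ε : Fin κ → ℝ)
    (ι : ∀ ℓ : Fin κ, M → EuclideanSpace ℝ (Fin (p ℓ))) (μ : Measure M)
    (i j : Fin κ) (x : View ι i) (y : View ι j) : ℝ :=
  ∫ w : View ι i,
    kernelAt K (ε i) (x : EuclideanSpace ℝ (Fin (p i))) w *
      kernelAt K (ε j) (transfer ι j i w : EuclideanSpace ℝ (Fin (p j))) y ∂(viewLaw ι μ i)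

/-- The operator `ω_{ij}`, taking functions on `ι_j(M)` to functions on `ι_i(M)`:
`ω_{ij} h (x) = 𝔼[K̃_{ij}(x, X_j) h(X_j)] / ∑_{k ≠ i} 𝔼[K̃_{ik}(x, X_k)]`. -/
def viewOperator (K : ℝ → ℝ) (ε : Fin κ → ℝ)
    (ι : ∀ ℓ : Fin κ, M → EuclideanSpace ℝ (Fin (p ℓ))) (μ : Measure M)
    (i j : Fin κ) (h : View ι j → ℝ) (x : View ι i) : ℝ :=
  (∫ z, transferKernel K ε ι μ i j x z * h z ∂(viewLaw ι μ j)) /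
    ∑ k ∈ Finset.univ.erase i, ∫ z, transferKernel K ε ι μ i k x z ∂(viewLaw ι μ k)

/-- The limiting operator `[Ω f]_i = ∑_{j ≠ i} ω_{ij} f_j`. -/
def limitOperator (K : ℝ → ℝ) (ε : Fin κ → ℝ)
    (ι : ∀ ℓ : Fin κ, M → EuclideanSpace ℝ (Fin (p ℓ))) (μ : Measure M)
    (f : ∀ j : Fin κ, View ι j → ℝ) (i : Fin κ) (x : View ι i) : ℝ :=
  ∑ j ∈ Finset.univ.erase i, viewOperator K ε ι μ i j (f j) x

end Operators

/-! ### The two sides of the comparison -/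

section Comparison

variable {M : Type*} {κ : ℕ} {p : Fin κ → ℕ}

/-- The clean transition matrix `Ǎ` built from the latent sample points `z₁, …, zₙ`, that is, from
the point clouds `ι_ℓ(z₁), …, ι_ℓ(zₙ)`. -/
def cleanTransition (K : ℝ → ℝ) (ε : Fin κ → ℝ)
    (ι : ∀ ℓ : Fin κ, M → EuclideanSpace ℝ (Fin (p ℓ))) {n : ℕ} (z : Fin n → M) :
    Matrix (Fin κ × Fin n) (Fin κ × Fin n) ℝ :=
  transitionMatrix fun ℓ => kernelMatrix K (ε ℓ) fun i => ι ℓ (z i)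

/-- The block vector with `ℓ`-th block `(f_ℓ(ι_ℓ(z₁)), …, f_ℓ(ι_ℓ(zₙ)))`. -/
def discretize (ι : ∀ ℓ : Fin κ, M → EuclideanSpace ℝ (Fin (p ℓ)))
    (f : ∀ j : Fin κ, View ι j → ℝ) {n : ℕ} (z : Fin n → M) : Fin κ × Fin n → ℝ :=
  fun a => f a.1 (toView ι a.1 (z a.2))

end Comparison

end GrabMDM

end

open GrabMDM

/-! ### Bernstein type concentration for sums of bounded independent variables. -/

section Concentration

variable {M : Type*} [MeasurableSpace M]

/-! Each entry of the transition matrix applied to the test vector is a ratio of double sums. The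
numerator is the sum over `i`, `j ≠ ℓ` and `m` of `k_ℓ(w, x_i) k_j(x_i, x_m) F_j(x_m)`, taken at `w
= x_s`; the denominator is the same sum with `F = 1`. By Fubini the limiting operator is the ratio
of the corresponding double integrals (`cleanTransition_mulVec`, `limitOperator_toView`), so a
relative concentration bound for such double sums is enough.

The sum is treated in two layers. Given `x_i`, the sum over `m` is a sum of independent bounded
terms. The kernel is nonnegative and bounded, so the variance of a term is at most a constant times
the kernel mean `h`. The sum therefore deviates from its mean by about `√(n h)`, which is a fraction
`1 / √(n h)` of `n h` (`real_abs_sum_sub_gt_le`). After a union bound over all `i` and `j`, the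
inner sums are replaced by their means. What remains is a single sum over `i`, to which the same
inequality applies, and `abs_weighted_sum_sub_le` adds the two errors. Numerator and denominator
have errors proportional to the same positive mean, so they can be divided (`real_ratio_sub_gt_le`).

Because errors are relative, lower bounds on the kernel means suffice, and these are of order `ε ^
(d / 2)` (`exists_le_integral_kernelAt`). The reason is geometric: an embedding is bi-Lipschitz in
charts, the volume density is bounded below in a chart, and `K` is bounded below near `1`; hence a
chart ball of radius comparable to `√ε` contributes to the mean. The layers then have relative
errors `1 / √(n ε_j ^ (d/2))` and `1 / √(n ε_ℓ ^ (d/2) ε_j ^ (d/2))` up to constants and powers `n ^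
υ`. Both are dominated by the stated rate. -/

theorem integrable_of_abs_le_const {μ : Measure M} [IsFiniteMeasure μ] {Z : M → ℝ}
    (hZ : Measurable Z) {B : ℝ} (h : ∀ v, |Z v| ≤ B) : Integrable Z μ :=
  Integrable.of_bound hZ.aestronglyMeasurable B (ae_of_all _ h)

/-- A Bernstein type bound on the moment generating function of a bounded variable. -/
theorem integral_exp_centered_le {μ : Measure M} [IsProbabilityMeasure μ] {Z Φ : M → ℝ}
    (hZ : Measurable Z) (hΦ : Measurable Φ) {B C l : ℝ} (hC : 0 ≤ C)
    (hΦ0 : ∀ v, 0 ≤ Φ v) (hΦB : ∀ v, Φ v ≤ B) (hZΦ : ∀ v, |Z v| ≤ C * Φ v)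
    (hl : |l| * (C * B) ≤ 1) :
    ∫ v, Real.exp (l * (Z v - ∫ u, Z u ∂μ)) ∂μ ≤ Real.exp (l ^ 2 * (C ^ 2 * B * ∫ u, Φ u ∂μ)) := by
  have hZB : ∀ v, |Z v| ≤ C * B := fun v =>
    (hZΦ v).trans (mul_le_mul_of_nonneg_left (hΦB v) hC)
  have hZi : Integrable Z μ := integrable_of_abs_le_const hZ hZB
  have hΦi : Integrable Φ μ :=
    integrable_of_abs_le_const hΦ fun v => by rw [abs_of_nonneg (hΦ0 v)]; exact hΦB v
  have hlZ : ∀ v, |l * Z v| ≤ 1 := fun v => by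
    rw [abs_mul]
    exact (mul_le_mul_of_nonneg_left (hZB v) (abs_nonneg l)).trans hl
  have hei : Integrable (fun v => Real.exp (l * Z v)) μ :=
    integrable_of_abs_le_const (by fun_prop) (B := Real.exp 1) fun v => by
      rw [abs_of_pos (Real.exp_pos _)]
      exact Real.exp_le_exp.2 ((le_abs_self _).trans (hlZ v))
  -- For `|y| ≤ 1` one has `exp y ≤ 1 + y + y²`. The square is linearized by `Z² ≤ C² Φ² ≤ C² B Φ`,
  -- so that the mean of `Φ` plays the role of the variance.
  have hpt : ∀ v, Real.exp (l * Z v) ≤ 1 + l * Z v + l ^ 2 * (C ^ 2 * B) * Φ v := fun v => by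
    have h1 := (abs_le.1 (Real.abs_exp_sub_one_sub_id_le (hlZ v))).2
    have h2 : Z v ^ 2 ≤ C ^ 2 * B * Φ v := by
      have : Z v ^ 2 ≤ (C * Φ v) ^ 2 := by
        rw [← sq_abs]
        exact pow_le_pow_left₀ (abs_nonneg _) (hZΦ v) 2
      have h3 : Φ v ^ 2 ≤ B * Φ v := by
        rw [sq]
        exact mul_le_mul_of_nonneg_right (hΦB v) (hΦ0 v)
      nlinarith [mul_le_mul_of_nonneg_left h3 (sq_nonneg C)]
    nlinarith [mul_le_mul_of_nonneg_left h2 (sq_nonneg l)]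
  have hint : ∫ v, Real.exp (l * Z v) ∂μ ≤
      1 + l * ∫ u, Z u ∂μ + l ^ 2 * (C ^ 2 * B) * ∫ u, Φ u ∂μ := by
    have hi1 : Integrable (fun v => 1 + l * Z v) μ := (integrable_const 1).add (hZi.const_mul l)
    have hi2 := hΦi.const_mul (l ^ 2 * (C ^ 2 * B))
    refine (integral_mono hei (hi1.add hi2) hpt).trans_eq ?_
    simp only [Pi.add_apply]
    rw [integral_add hi1 hi2, integral_add (integrable_const 1) (hZi.const_mul l),
      integral_const_mul, integral_const_mul]
    simp
  have hfac : ∀ v, Real.exp (l * (Z v - ∫ u, Z u ∂μ)) =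
      Real.exp (-(l * ∫ u, Z u ∂μ)) * Real.exp (l * Z v) := fun v => by
    rw [← Real.exp_add]; congr 1; ring
  simp_rw [hfac]
  rw [integral_const_mul]
  calc _ ≤ Real.exp (-(l * ∫ u, Z u ∂μ)) *
        Real.exp (l * ∫ u, Z u ∂μ + l ^ 2 * (C ^ 2 * B * ∫ u, Φ u ∂μ)) := by
        refine mul_le_mul_of_nonneg_left ?_ (Real.exp_pos _).le
        refine hint.trans ?_
        have := Real.add_one_le_exp (l * ∫ u, Z u ∂μ + l ^ 2 * (C ^ 2 * B * ∫ u, Φ u ∂μ))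
        linarith
    _ = _ := by rw [← Real.exp_add]; congr 1; ring

/-- The one-sided tail bound for a sum of independent bounded variables. -/
theorem pi_real_sum_ge_le {μ : Measure M} [IsProbabilityMeasure μ] {Z Φ : M → ℝ}
    (hZ : Measurable Z) (hΦ : Measurable Φ) {B C l : ℝ} (hC : 0 ≤ C)
    (hΦ0 : ∀ v, 0 ≤ Φ v) (hΦB : ∀ v, Φ v ≤ B) (hZΦ : ∀ v, |Z v| ≤ C * Φ v)
    (hl0 : 0 ≤ l) (hl : l * (C * B) ≤ 1) (T : Type*) [Fintype T] (t : ℝ) :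
    (Measure.pi fun _ : T => μ).real {v | t ≤ ∑ m, (Z (v m) - ∫ u, Z u ∂μ)} ≤
      Real.exp (-l * t + Fintype.card T * (l ^ 2 * (C ^ 2 * B * ∫ u, Φ u ∂μ))) := by
  have hZB : ∀ v, |Z v| ≤ C * B := fun v =>
    (hZΦ v).trans (mul_le_mul_of_nonneg_left (hΦB v) hC)
  have hexp : ∀ v : T → M, Real.exp (l * ∑ m, (Z (v m) - ∫ u, Z u ∂μ)) =
      ∏ m, Real.exp (l * (Z (v m) - ∫ u, Z u ∂μ)) := fun v => by
    rw [← Real.exp_sum, Finset.mul_sum]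
  have hmgf : mgf (fun v : T → M => ∑ m, (Z (v m) - ∫ u, Z u ∂μ)) (Measure.pi fun _ => μ) l =
      (∫ v, Real.exp (l * (Z v - ∫ u, Z u ∂μ)) ∂μ) ^ Fintype.card T := by
    unfold mgf
    simp_rw [hexp]
    exact integral_fintype_prod_eq_pow (μ := μ)
      (fun v => Real.exp (l * (Z v - ∫ u, Z u ∂μ)))
  have hint : Integrable (fun v : T → M => Real.exp (l * ∑ m, (Z (v m) - ∫ u, Z u ∂μ)))
      (Measure.pi fun _ => μ) := by
    simp_rw [hexp]
    refine Integrable.fintype_prod (f := fun _ v => Real.exp (l * (Z v - ∫ u, Z u ∂μ))) fun _ => ?_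
    refine integrable_of_abs_le_const (by fun_prop)
      (B := Real.exp (l * (C * B - ∫ u, Z u ∂μ))) fun v => ?_
    rw [abs_of_pos (Real.exp_pos _)]
    refine Real.exp_le_exp.2 (mul_le_mul_of_nonneg_left ?_ hl0)
    linarith [le_abs_self (Z v), hZB v]
  refine (measure_ge_le_exp_mul_mgf t hl0 hint).trans ?_
  rw [hmgf, Real.exp_add, Real.exp_nat_mul]
  refine mul_le_mul_of_nonneg_left ?_ (Real.exp_pos _).le
  refine pow_le_pow_left₀ (integral_nonneg fun _ => (Real.exp_pos _).le) ?_ _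
  exact integral_exp_centered_le hZ hΦ hC hΦ0 hΦB hZΦ (by rwa [abs_of_nonneg hl0])

/-- Chernoff's bound for `Z` and `-Z`, with the deviation measured in units of `√(n ∫ Φ)`. The
number of summands is allowed to be below `n` because one sample point will be set aside. -/
theorem pi_real_abs_sum_ge_le {μ : Measure M} [IsProbabilityMeasure μ] {Z Φ : M → ℝ}
    (hZ : Measurable Z) (hΦ : Measurable Φ) {B C : ℝ} (hC : 0 < C) (hB : 1 ≤ B)
    (hΦ0 : ∀ v, 0 ≤ Φ v) (hΦB : ∀ v, Φ v ≤ B) (hZΦ : ∀ v, |Z v| ≤ C * Φ v)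
    {n : ℕ} (hn : 1 ≤ n * ∫ u, Φ u ∂μ) (T : Type*) [Fintype T] (hT : Fintype.card T ≤ n) (R : ℝ) :
    (Measure.pi fun _ : T => μ).real
      {v | C * B * √(n * ∫ u, Φ u ∂μ) * R ≤ |∑ m, (Z (v m) - ∫ u, Z u ∂μ)|} ≤
      2 * Real.exp (1 - R) := by
  set φ := ∫ u, Φ u ∂μ with hφ
  set q := √(n * φ) with hq
  have hφ0 : 0 ≤ φ := integral_nonneg hΦ0
  have hq1 : 1 ≤ q := Real.one_le_sqrt.2 hn
  have hq2 : q ^ 2 = n * φ := Real.sq_sqrt (by linarith)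
  have hCB : 0 < C * B := by positivity
  -- With this `l` the linear term of the exponent is exactly `-R` and the quadratic one is at most
  -- `1 / B ≤ 1`. The constraint `l * (C * B) ≤ 1` amounts to `q ≥ 1`, which is `hn`.
  set l := 1 / (C * B * q) with hl
  have hl0 : 0 ≤ l := by positivity
  have hl1 : l * (C * B) ≤ 1 := by
    rw [hl, div_mul_eq_mul_div, one_mul, div_le_one (by positivity)]
    nlinarith
  have hexpo : -l * (C * B * q * R) + Fintype.card T * (l ^ 2 * (C ^ 2 * B * φ)) ≤ 1 - R := by
    have h1 : l * (C * B * q) = 1 := by rw [hl]; field_simp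
    have h2 : (Fintype.card T : ℝ) * (l ^ 2 * (C ^ 2 * B * φ)) ≤
        n * (l ^ 2 * (C ^ 2 * B * φ)) := by
      refine mul_le_mul_of_nonneg_right (by exact_mod_cast hT) (by positivity)
    have h3 : n * (l ^ 2 * (C ^ 2 * B * φ)) * B = 1 := by
      calc _ = (l * (C * B)) ^ 2 * (n * φ) := by ring
        _ = (l * (C * B * q)) ^ 2 := by rw [← hq2]; ring
        _ = 1 := by rw [h1]; norm_num
    have h4 : n * (l ^ 2 * (C ^ 2 * B * φ)) ≤ 1 := by
      rw [← h3]
      exact le_mul_of_one_le_right (by positivity) hB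
    have h5 : -l * (C * B * q * R) = -R := by linear_combination (-R) * h1
    linarith
  have h1 := pi_real_sum_ge_le (μ := μ) hZ hΦ hC.le hΦ0 hΦB hZΦ hl0 hl1 T (C * B * q * R)
  have h2 := pi_real_sum_ge_le (μ := μ) hZ.neg hΦ hC.le hΦ0 hΦB
    (fun v => by simpa using hZΦ v) hl0 hl1 T (C * B * q * R)
  have hsub : {v : T → M | C * B * q * R ≤ |∑ m, (Z (v m) - ∫ u, Z u ∂μ)|} ⊆
      {v | C * B * q * R ≤ ∑ m, (Z (v m) - ∫ u, Z u ∂μ)} ∪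
      {v | C * B * q * R ≤ ∑ m, ((-Z) (v m) - ∫ u, (-Z) u ∂μ)} := by
    intro v hv
    have hv' : C * B * q * R ≤ |∑ m, (Z (v m) - ∫ u, Z u ∂μ)| := hv
    rcases le_abs.1 hv' with h | h
    · exact Or.inl h
    · refine Or.inr ?_
      simp only [Set.mem_ofPred_eq, Pi.neg_apply, integral_neg]
      refine h.trans_eq ?_
      rw [← Finset.sum_neg_distrib]
      exact Finset.sum_congr rfl fun _ _ => by ring
  refine (measureReal_mono hsub).trans ((measureReal_union_le _ _).trans ?_)
  have h3 := Real.exp_le_exp.2 hexpo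
  linarith

/-- Conditional concentration of `∑ₘ Y(xₖ, xₘ)` around `n 𝔼[Y(xₖ, X) | xₖ]`. -/
theorem real_abs_sum_sub_gt_le {S : Type*} [MeasurableSpace S] {P : Measure S}
    [IsProbabilityMeasure P] {μ : Measure M} [IsProbabilityMeasure μ] {x : ℕ → S → M}
    (hx_indep : iIndepFun x P) (hxm : ∀ i, AEMeasurable (x i) P) (hxl : ∀ i, P.map (x i) = μ)
    {Y Φ : M → M → ℝ} (hY : Measurable (Function.uncurry Y))
    (hΦ : Measurable (Function.uncurry Φ)) {B C : ℝ} (hC : 0 < C) (hB : 1 ≤ B)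
    (hΦ0 : ∀ w v, 0 ≤ Φ w v) (hΦB : ∀ w v, Φ w v ≤ B) (hYΦ : ∀ w v, |Y w v| ≤ C * Φ w v)
    {n : ℕ} (hn : ∀ w, 1 ≤ n * ∫ u, Φ w u ∂μ) (R : ℝ) (k : Fin n) :
    P.real {a | C * B * √(n * ∫ u, Φ (x k a) u ∂μ) * (R + 2) <
      |∑ m : Fin n, Y (x k a) (x m a) - n * ∫ u, Y (x k a) u ∂μ|} ≤ 2 * Real.exp (1 - R) := by
  classical
  -- Removing the index `k` makes the remaining sample independent of `x k`, which can then be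
  -- frozen.
  set T : Finset ℕ := (Finset.range n).erase k with hT
  have hkn : (k : ℕ) ∈ Finset.range n := Finset.mem_range.2 k.2
  have hcard : Fintype.card T ≤ n := by
    rw [Fintype.card_coe]
    exact (Finset.card_erase_le).trans (by simp)
  set V : S → (T → M) := fun a m => x m a with hV
  have hVm : AEMeasurable V P := aemeasurable_pi_lambda _ fun m => hxm m
  have hVl : P.map V = Measure.pi fun _ : T => μ := by
    have h1 : iIndepFun (fun m : T => x (m : ℕ)) P := hx_indep.precomp Subtype.val_injective
    have h2 := h1.map_fun_eq_pi_map (fun m : T => hxm m)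
    simp only [hxl] at h2
    exact h2
  have hind : IndepFun (x k) V P := by
    have h := hx_indep.indepFun_finset₀ {(k : ℕ)} T (by simp [hT]) hxm
    exact h.comp (φ := fun v : (({(k : ℕ)} : Finset ℕ) → M) => v ⟨k, by simp⟩) (ψ := id)
      (measurable_pi_apply _) measurable_id
  set y : M → ℝ := fun w => ∫ u, Y w u ∂μ with hy
  set φ : M → ℝ := fun w => ∫ u, Φ w u ∂μ with hφ
  have hym : Measurable y := (hY.stronglyMeasurable.integral_prod_right (ν := μ)).measurable
  have hφm : Measurable φ := (hΦ.stronglyMeasurable.integral_prod_right (ν := μ)).measurable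
  set A : Set (M × (T → M)) :=
    {p | C * B * √(n * φ p.1) * R ≤ |∑ m, (Y p.1 (p.2 m) - y p.1)|} with hA
  have hAm : MeasurableSet A := by
    have hYm : ∀ m : T, Measurable fun p : M × (T → M) => Y p.1 (p.2 m) := fun m =>
      hY.comp (measurable_fst.prodMk ((measurable_pi_apply m).comp measurable_snd))
    refine measurableSet_le ?_ ?_
    · exact ((((hφm.comp measurable_fst).const_mul _).sqrt).const_mul _).mul_const _
    · have : Measurable fun p : M × (T → M) => ∑ m, (Y p.1 (p.2 m) - y p.1) :=
        Finset.measurable_sum _ fun m _ => (hYm m).sub (hym.comp measurable_fst)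
      exact this.abs
  have hlaw : P.map (fun a => (x k a, V a)) = μ.prod (Measure.pi fun _ : T => μ) := by
    rw [(indepFun_iff_map_prod_eq_prod_map_map (hxm k) hVm).1 hind, hxl, hVl]
  have hsub : {a | C * B * √(n * φ (x k a)) * (R + 2) <
      |∑ m : Fin n, Y (x k a) (x m a) - n * y (x k a)|} ⊆ (fun a => (x k a, V a)) ⁻¹' A := by
    intro a ha
    simp only [Set.mem_ofPred_eq] at ha
    set w := x k a with hw
    have hsum : ∑ m : Fin n, Y w (x m a) - n * y w =
        ∑ m : T, (Y w (V a m) - y w) + (Y w w - y w) := by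
      have h1 : ∑ m : T, (Y w (V a m) - y w) = ∑ m ∈ T, (Y w (x m a) - y w) :=
        Finset.sum_coe_sort T fun m => Y w (x m a) - y w
      rw [h1, hT, Finset.sum_erase_add _ _ hkn, Finset.sum_sub_distrib, Finset.sum_const,
        Finset.card_range, nsmul_eq_mul, Finset.sum_range]
    have hYB : ∀ v, |Y w v| ≤ C * B := fun v =>
      (hYΦ w v).trans (mul_le_mul_of_nonneg_left (hΦB w v) hC.le)
    have hyB : |y w| ≤ C * B := by
      have := norm_integral_le_of_norm_le_const (μ := μ) (f := Y w)
        (ae_of_all _ fun v => (Real.norm_eq_abs _).trans_le (hYB v))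
      simpa using this
    -- The removed diagonal term costs at most `2 C B`; since `√(n φ) ≥ 1`, this is the `+ 2` in `R
    -- + 2`.
    have hdiag : |Y w w - y w| ≤ C * B * √(n * φ w) * 2 := by
      have h1 : |Y w w - y w| ≤ C * B * 2 := by
        linarith [abs_sub (Y w w) (y w), hYB w]
      have h2 : 1 ≤ √(n * φ w) := Real.one_le_sqrt.2 (hn w)
      have h3 : 0 < C * B := by positivity
      nlinarith
    rw [hsum] at ha
    change C * B * √(n * φ w) * R ≤ |∑ m, (Y w (V a m) - y w)|
    linarith [abs_add_le (∑ m : T, (Y w (V a m) - y w)) (Y w w - y w)]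
  -- The bound is uniform in the frozen point, so integrating the fibres over the product law
  -- preserves it.
  have hfib : ∀ w, (Measure.pi fun _ : T => μ) (Prod.mk w ⁻¹' A) ≤
      ENNReal.ofReal (2 * Real.exp (1 - R)) := fun w => by
    have := pi_real_abs_sum_ge_le (μ := μ) (hY.comp measurable_prodMk_left)
      (hΦ.comp measurable_prodMk_left) hC hB (hΦ0 w) (hΦB w) (hYΦ w) (hn w) T hcard R
    rw [← ENNReal.ofReal_toReal (measure_ne_top _ _)]
    exact ENNReal.ofReal_le_ofReal this
  have hPA : P ((fun a => (x k a, V a)) ⁻¹' A) ≤ ENNReal.ofReal (2 * Real.exp (1 - R)) := by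
    rw [← Measure.map_apply_of_aemeasurable ((hxm k).prodMk hVm) hAm, hlaw,
      Measure.prod_apply hAm]
    exact (lintegral_mono hfib).trans (by simp)
  refine (measureReal_mono hsub).trans ?_
  exact ENNReal.toReal_le_of_le_ofReal (by positivity) hPA

end Concentration

/-! ### Immersions are locally bi-Lipschitz in charts. -/

section BiLipschitz

variable {d q : ℕ} {M : Type*} [TopologicalSpace M]
  [ChartedSpace (EuclideanSpace ℝ (Fin d)) M] [IsManifold (𝓡 d) ∞ M]

omit [IsManifold (𝓡 d) ∞ M] in
/-- An immersion into a Euclidean space has, near each point, a smooth left inverse. -/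
theorem exists_contMDiffAt_left_inverse {f : M → EuclideanSpace ℝ (Fin q)} {x : M}
    (hf : Manifold.IsImmersionAt (𝓡 d) 𝓘(ℝ, EuclideanSpace ℝ (Fin q)) ∞ f x) :
    ∃ G : EuclideanSpace ℝ (Fin q) → M,
      ContMDiffAt 𝓘(ℝ, EuclideanSpace ℝ (Fin q)) (𝓡 d) ∞ G (f x) ∧ ∀ᶠ y in 𝓝 x, G (f y) = y := by
  have hsrc := hf.domChart.open_source.mem_nhds hf.mem_domChart_source
  -- In adapted charts the immersion reads `u ↦ (u, 0)`, so the first component recovers the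
  -- coordinates of the point.
  have hval : ∀ y ∈ hf.domChart.source,
      (hf.equiv.symm (hf.codChart.extend 𝓘(ℝ, EuclideanSpace ℝ (Fin q)) (f y))).1 =
        hf.domChart.extend (𝓡 d) y := fun y hy => by
    have hy' : y ∈ (hf.domChart.extend (𝓡 d)).source := by
      rwa [OpenPartialHomeomorph.extend_source]
    have h1 := hf.writtenInCharts ((hf.domChart.extend (𝓡 d)).map_source hy')
    simp only [Function.comp_apply] at h1
    rw [(hf.domChart.extend (𝓡 d)).left_inv hy'] at h1
    rw [h1]
    simp
  refine ⟨fun z => (hf.domChart.extend (𝓡 d)).symm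
    (hf.equiv.symm (hf.codChart.extend 𝓘(ℝ, EuclideanSpace ℝ (Fin q)) z)).1, ?_, ?_⟩
  · have h1 : ContMDiffAt 𝓘(ℝ, EuclideanSpace ℝ (Fin q)) 𝓘(ℝ, EuclideanSpace ℝ (Fin q)) ∞
        (hf.codChart.extend 𝓘(ℝ, EuclideanSpace ℝ (Fin q))) (f x) :=
      hf.codChart.contMDiffAt_extend hf.codChart_mem_maximalAtlas hf.mem_codChart_source
    have h2 : ContMDiffAt 𝓘(ℝ, EuclideanSpace ℝ (Fin q)) 𝓘(ℝ, EuclideanSpace ℝ (Fin d)) ∞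
        (fun z => (hf.equiv.symm z).1)
        (hf.codChart.extend 𝓘(ℝ, EuclideanSpace ℝ (Fin q)) (f x)) :=
      ((ContinuousLinearMap.fst ℝ _ _).contDiff.comp
        hf.equiv.symm.contDiff).contDiffAt.contMDiffAt
    have h3 : ContMDiffAt 𝓘(ℝ, EuclideanSpace ℝ (Fin d)) (𝓡 d) ∞
        (hf.domChart.extend (𝓡 d)).symm (hf.domChart.extend (𝓡 d) x) := by
      refine (contMDiffOn_extend_symm hf.domChart_mem_maximalAtlas).contMDiffAt ?_
      have h4 : (𝓡 d) '' hf.domChart.target = hf.domChart.target := by simp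
      rw [h4]
      exact hf.domChart.open_target.mem_nhds (hf.domChart.map_source hf.mem_domChart_source)
    rw [← hval x hf.mem_domChart_source] at h3
    exact h3.comp (f x) (h2.comp (f x) h1)
  · filter_upwards [hsrc] with y hy
    rw [hval y hy]
    exact hf.domChart.extend_left_inv hy

/-- An immersion read in the preferred chart is bi-Lipschitz near the base point. -/
theorem exists_biLipschitz_chart {f : M → EuclideanSpace ℝ (Fin q)} {c : M}
    (hf : Manifold.IsImmersionAt (𝓡 d) 𝓘(ℝ, EuclideanSpace ℝ (Fin q)) ∞ f c) :
    ∃ L > 0, ∃ m > 0, ∀ᶠ r in 𝓝[>] (0 : ℝ),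
      ∀ u ∈ Metric.ball (extChartAt (𝓡 d) c c) r, ∀ v ∈ Metric.ball (extChartAt (𝓡 d) c c) r,
        ‖f ((extChartAt (𝓡 d) c).symm u) - f ((extChartAt (𝓡 d) c).symm v)‖ ≤ L * ‖u - v‖ ∧
        m * ‖u - v‖ ≤
          ‖f ((extChartAt (𝓡 d) c).symm u) - f ((extChartAt (𝓡 d) c).symm v)‖ := by
  obtain ⟨G, hG, hGf⟩ := exists_contMDiffAt_left_inverse hf
  set φ := extChartAt (𝓡 d) c with hφ
  set u₀ := φ c with hu₀
  have hsymm : φ.symm u₀ = c := extChartAt_to_inv c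
  have hφs : ContMDiffAt 𝓘(ℝ, EuclideanSpace ℝ (Fin d)) (𝓡 d) ∞ φ.symm u₀ :=
    (contMDiffOn_extChartAt_symm c).contMDiffAt (extChartAt_target_mem_nhds c)
  have hF : ContDiffAt ℝ ∞ (f ∘ φ.symm) u₀ := by
    rw [← contMDiffAt_iff_contDiffAt]
    exact (ContMDiffAt.comp u₀ (by rw [hsymm]; exact hf.contMDiffAt) hφs)
  have hGc : G (f c) = c := hGf.self_of_nhds
  have hH : ContDiffAt ℝ ∞ (φ ∘ G) (f c) := by
    rw [← contMDiffAt_iff_contDiffAt]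
    exact (ContMDiffAt.comp (f c) (by rw [hGc]; exact contMDiffAt_extChartAt) hG)
  have h1 : (1 : WithTop ℕ∞) ≤ ∞ := by exact_mod_cast le_top
  obtain ⟨L₁, s, hs, hLs⟩ := (hF.of_le h1).exists_lipschitzOnWith
  obtain ⟨L₂, t, ht, hLt⟩ := (hH.of_le h1).exists_lipschitzOnWith
  have hcont : Tendsto φ.symm (𝓝 u₀) (𝓝 c) := by
    have := hφs.continuousAt
    rwa [ContinuousAt, hsymm] at this
  have hFt : ∀ᶠ u in 𝓝 u₀, f (φ.symm u) ∈ t := by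
    have : Tendsto (f ∘ φ.symm) (𝓝 u₀) (𝓝 (f c)) := hf.continuousAt.tendsto.comp hcont
    exact this.eventually ht
  have hev : ∀ᶠ u in 𝓝 u₀, u ∈ s ∧ f (φ.symm u) ∈ t ∧ φ (G (f (φ.symm u))) = u := by
    filter_upwards [hs, hFt, hcont.eventually hGf, extChartAt_target_mem_nhds (I := 𝓡 d) c]
      with u h1 h2 h3 h4
    exact ⟨h1, h2, by rw [h3]; exact φ.right_inv h4⟩
  obtain ⟨r₀, hr₀, hball⟩ := Metric.eventually_nhds_iff_ball.1 hev
  -- `L₁` is a Lipschitz constant of `f` in the chart and `L₂` one of its left inverse; adding `1`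
  -- keeps both positive.
  refine ⟨L₁ + 1, by positivity, (L₂ + 1 : ℝ)⁻¹, by positivity, ?_⟩
  filter_upwards [Ioo_mem_nhdsGT hr₀] with r hr u hu v hv
  obtain ⟨hus, hut, hu'⟩ := hball u (Metric.ball_subset_ball hr.2.le hu)
  obtain ⟨hvs, hvt, hv'⟩ := hball v (Metric.ball_subset_ball hr.2.le hv)
  constructor
  · refine (hLs.norm_sub_le hus hvs).trans ?_
    exact mul_le_mul_of_nonneg_right (by linarith) (norm_nonneg _)
  · have h2 := hLt.norm_sub_le hut hvt
    simp only [Function.comp_apply, hu', hv'] at h2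
    rw [inv_mul_le_iff₀ (by positivity)]
    refine h2.trans (mul_le_mul_of_nonneg_right (by linarith) (norm_nonneg _))

end BiLipschitz

/-! ### Lower bound for the Riemannian volume density in a chart. -/

section Gram

/-- Testing the form on unit eigenvectors bounds every eigenvalue below by `c`, and the determinant
is their product. -/
theorem pow_le_det_of_le_quadratic {d : ℕ} {G : Matrix (Fin d) (Fin d) ℝ} (hG : G.IsHermitian)
    {c : ℝ} (hc : 0 ≤ c)
    (h : ∀ v : EuclideanSpace ℝ (Fin d), c * ‖v‖ ^ 2 ≤ dotProduct v.ofLp (G.mulVec v.ofLp)) :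
    c ^ d ≤ G.det := by
  have hev : ∀ i, c ≤ hG.eigenvalues i := fun i => by
    have h1 := h (hG.eigenvectorBasis i)
    rw [hG.mulVec_eigenvectorBasis, hG.eigenvectorBasis.orthonormal.1 i] at h1
    rw [dotProduct_smul] at h1
    have h2 : dotProduct (hG.eigenvectorBasis i).ofLp (hG.eigenvectorBasis i).ofLp = 1 := by
      have := hG.eigenvectorBasis.orthonormal.1 i
      have h3 := EuclideanSpace.real_norm_sq_eq (hG.eigenvectorBasis i)
      rw [this] at h3
      simp only [dotProduct, ← sq]
      linarith
    rw [h2] at h1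
    simpa using h1
  rw [hG.det_eq_prod_eigenvalues]
  calc c ^ d = ∏ _i : Fin d, c := by simp
    _ ≤ _ := Finset.prod_le_prod (fun _ _ => hc) fun i _ => by simpa using hev i

variable {d : ℕ} {M : Type*} [TopologicalSpace M]
  [ChartedSpace (EuclideanSpace ℝ (Fin d)) M] [IsManifold (𝓡 d) ∞ M]

-- Continuity of the metric makes the tangent trivialization at `c` bounded near `c`, and this
-- trivialization is the derivative of the chart. The separate variable `D` with an equation fixes
-- the type of the derivative.
open Bundle in
theorem exists_le_metric_of_mfderiv (g : ContMDiffRiemannianMetric (𝓡 d) ∞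
      (EuclideanSpace ℝ (Fin d)) (fun x : M => TangentSpace (𝓡 d) x)) (c : M) :
    ∃ C : ℝ, 0 < C ∧ ∀ᶠ y in 𝓝 c, ∀ D : TangentSpace (𝓡 d) y →L[ℝ] EuclideanSpace ℝ (Fin d),
      D = mfderiv (𝓡 d) 𝓘(ℝ, EuclideanSpace ℝ (Fin d)) (extChartAt (𝓡 d) c) y →
      ∀ v : TangentSpace (𝓡 d) y, ‖D v‖ ≤ C * √(g.inner y v v) := by
  let : RiemannianBundle (fun x : M => TangentSpace (𝓡 d) x) := ⟨g.toRiemannianMetric⟩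
  have : IsContinuousRiemannianBundle (EuclideanSpace ℝ (Fin d))
      (fun x : M => TangentSpace (𝓡 d) x) :=
    ⟨g.inner, g.contMDiff.continuous, fun _ _ _ => rfl⟩
  obtain ⟨C, hC, h⟩ := eventually_norm_trivializationAt_lt (EuclideanSpace ℝ (Fin d))
    (fun x : M => TangentSpace (𝓡 d) x) c
  refine ⟨C, hC, ?_⟩
  filter_upwards [h, chart_source_mem_nhds (EuclideanSpace ℝ (Fin d)) c] with y hy h'y D hD v
  rw [hD, ← TangentBundle.continuousLinearMapAt_trivializationAt h'y]
  have h1 := ContinuousLinearMap.le_of_opNorm_le _ hy.le v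
  have h2 : ‖v‖ = √(g.inner y v v) := norm_eq_sqrt_real_inner v
  rw [← h2]
  exact h1

/-- The derivatives `A` of the inverse chart and `D` of the chart satisfy `D (A v) = v`. Hence `‖v‖
≤ C |A v|_g`, so the Gram form is at least `C⁻² ‖v‖²`. -/
theorem exists_le_sqrt_det_chartGram (g : Bundle.ContMDiffRiemannianMetric (𝓡 d) ∞
      (EuclideanSpace ℝ (Fin d)) (fun x : M => TangentSpace (𝓡 d) x)) (c : M) :
    ∃ b : ℝ, 0 < b ∧ ∀ᶠ u in 𝓝 (extChartAt (𝓡 d) c c), b ≤ √(chartGram g c u).det := by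
  obtain ⟨C, hC, hev⟩ := exists_le_metric_of_mfderiv g c
  set φ := extChartAt (𝓡 d) c with hφ
  have hcont : Tendsto φ.symm (𝓝 (φ c)) (𝓝 c) := by
    have h : ContinuousAt φ.symm (φ c) := continuousAt_extChartAt_symm c
    rwa [ContinuousAt, extChartAt_to_inv c] at h
  refine ⟨√((C ^ 2)⁻¹ ^ d), by positivity, ?_⟩
  filter_upwards [hcont.eventually hev,
    (isOpen_extChartAt_target c).mem_nhds (mem_extChartAt_target (I := 𝓡 d) c)] with u hu hut
  refine Real.sqrt_le_sqrt ?_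
  set A : EuclideanSpace ℝ (Fin d) →L[ℝ] TangentSpace (𝓡 d) (φ.symm u) :=
    mfderiv 𝓘(ℝ, EuclideanSpace ℝ (Fin d)) (𝓡 d) φ.symm u with hA
  set D : TangentSpace (𝓡 d) (φ.symm u) →L[ℝ] EuclideanSpace ℝ (Fin d) :=
    mfderiv (𝓡 d) 𝓘(ℝ, EuclideanSpace ℝ (Fin d)) φ (φ.symm u) with hD
  have hinv : ∀ v : EuclideanSpace ℝ (Fin d), D (A v) = v := fun v => by
    have h := mfderiv_extChartAt_comp_mfderivWithin_extChartAt_symm (I := 𝓡 d) hut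
    rw [modelWithCornersSelf_coe, Set.range_id, mfderivWithin_univ] at h
    exact congrArg (fun T => T v) h
  have hsum : ∀ v : EuclideanSpace ℝ (Fin d),
      A v = ∑ a, v a • A (EuclideanSpace.single a (1 : ℝ)) := fun v => by
    simp_rw [← map_smul]
    rw [← map_sum]
    congr 1
    ext i
    simp [Pi.single_apply]
  have hquad : ∀ v : EuclideanSpace ℝ (Fin d),
      dotProduct v.ofLp ((chartGram g c u).mulVec v.ofLp) = g.inner (φ.symm u) (A v) (A v) :=
    fun v => by
    have h1 : ∀ a b, chartGram g c u a b =
      g.inner (φ.symm u) (A (EuclideanSpace.single a 1)) (A (EuclideanSpace.single b 1)) :=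
      fun a b => rfl
    rw [hsum v]
    simp only [dotProduct, Matrix.mulVec, h1, map_sum, map_smul, sum_apply,
      smul_apply, smul_eq_mul, Finset.mul_sum]
    refine Finset.sum_congr rfl fun a _ => Finset.sum_congr rfl fun b _ => by
      rw [g.symm]
      ring
  refine pow_le_det_of_le_quadratic ?_ (by positivity) fun v => ?_
  · ext a b
    simp only [chartGram, Matrix.conjTranspose_apply, Matrix.of_apply, star_trivial]
    exact g.symm _ _ _
  · rw [hquad, inv_mul_le_iff₀ (by positivity)]
    have h1 := hu D hD (A v)
    rw [hinv] at h1
    have h2 : 0 ≤ g.inner (φ.symm u) (A v) (A v) := by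
      by_cases h : A v = 0
      · simp [h]
      · exact (g.pos _ _ h).le
    calc ‖v‖ ^ 2 ≤ (C * √(g.inner (φ.symm u) (A v) (A v))) ^ 2 :=
          pow_le_pow_left₀ (norm_nonneg _) h1 2
      _ = _ := by rw [mul_pow, Real.sq_sqrt h2]

end Gram

/-! ### Kernel means are at least of order `ε ^ (d / 2)`. -/

section KernelLowerBound

/-- `K` is continuous at `1` but need not be at `0`, so positivity spreads to an interval around `1`
only. The variable `s` stands for distance over `√ε`; the value at `0` is kept for dimension zero.
-/
theorem GrabMDM.IsAdmissibleKernel.exists_pos_le {d : ℕ} {K : ℝ → ℝ} (hK : IsAdmissibleKernel d K) :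
    ∃ k₀ > 0, k₀ ≤ K 0 ∧ ∃ η > 0, ∀ s : ℝ, |s - 1| ≤ η → k₀ ≤ K (s ^ 2) := by
  have hc : ContinuousAt (fun s : ℝ => K (s ^ 2)) 1 := by
    have h1 : ContinuousAt K (1 ^ 2) := by
      rw [one_pow]
      exact hK.contDiffOn.continuousOn.continuousAt (Ioi_mem_nhds _root_.one_pos)
    exact ContinuousAt.comp (f := fun s : ℝ => s ^ 2) h1 (by fun_prop)
  have h1 : K 1 / 2 < K ((1 : ℝ) ^ 2) := by
    rw [one_pow]
    linarith [hK.one_pos]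
  obtain ⟨η, hη, h⟩ := Metric.eventually_nhds_iff_ball.1 (hc.eventually (lt_mem_nhds h1))
  refine ⟨min (K 0) (K 1 / 2), lt_min hK.zero_pos (half_pos hK.one_pos), min_le_left _ _,
    η / 2, half_pos hη, fun s hs => (min_le_right _ _).trans (h s ?_).le⟩
  rw [Metric.mem_ball, Real.dist_eq]
  linarith

/-- Nothing is known about `K` on the negative axis, so `K` is replaced by a piecewise continuous
function that agrees with it on the nonnegative arguments that occur. -/
theorem GrabMDM.IsAdmissibleKernel.measurable_kernelAt {d : ℕ} {K : ℝ → ℝ} (hK : IsAdmissibleKernel d K)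
    {E : Type*} [NormedAddCommGroup E] [MeasurableSpace E] [BorelSpace E]
    [SecondCountableTopology E] {α : Type*} [MeasurableSpace α] {ε : ℝ} (hε : 0 < ε)
    {u v : α → E} (hu : Measurable u) (hv : Measurable v) :
    Measurable fun a => kernelAt K ε (u a) (v a) := by
  classical
  have h1 : Measurable ((Set.Ioi (0 : ℝ)).piecewise K fun _ => K 0) :=
    hK.contDiffOn.continuousOn.measurable_piecewise continuousOn_const measurableSet_Ioi
  have h2 : (fun a => kernelAt K ε (u a) (v a)) =
      (Set.Ioi (0 : ℝ)).piecewise K (fun _ => K 0) ∘ fun a => ‖u a - v a‖ ^ 2 / ε := by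
    funext a
    have h3 : 0 ≤ ‖u a - v a‖ ^ 2 / ε := by positivity
    rcases h3.eq_or_lt with h | h
    · simp [kernelAt, ← h]
    · simp [kernelAt, Set.piecewise_eq_of_mem _ _ _ (Set.mem_Ioi.2 h)]
  rw [h2]
  exact h1.comp (by fun_prop)

/-- If `F` is bi-Lipschitz on a ball, then `K(‖F v - F u‖² / ε)` is bounded below for `u` in some
ball of radius comparable to `√ε`. -/
theorem exists_ball_le_kernelAt {d : ℕ} {K : ℝ → ℝ} {k₀ η : ℝ} (hη : 0 < η) (hk0 : k₀ ≤ K 0)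
    (hk1 : ∀ s : ℝ, |s - 1| ≤ η → k₀ ≤ K (s ^ 2)) {E : Type*} [NormedAddCommGroup E]
    {F : EuclideanSpace ℝ (Fin d) → E} {u₀ : EuclideanSpace ℝ (Fin d)} {r L m : ℝ}
    (hL : 0 < L) (hm : 0 < m)
    (hF : ∀ u ∈ Metric.ball u₀ r, ∀ v ∈ Metric.ball u₀ r,
      ‖F u - F v‖ ≤ L * ‖u - v‖ ∧ m * ‖u - v‖ ≤ ‖F u - F v‖)
    {ε : ℝ} (hε : 0 < ε) (hεr : (1 / m + η / L) * √ε < r / 2)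
    {v : EuclideanSpace ℝ (Fin d)} (hv : v ∈ Metric.ball u₀ (r / 2)) :
    ∃ w, Metric.ball w (η / L * √ε) ⊆ Metric.ball u₀ r ∧
      ∀ u ∈ Metric.ball w (η / L * √ε), k₀ ≤ kernelAt K ε (F v) (F u) := by
  have hs : 0 < √ε := Real.sqrt_pos.2 hε
  have hηL : 0 < η / L := div_pos hη hL
  have hm' : 0 < 1 / m := by positivity
  have hvd : dist v u₀ < r / 2 := hv
  have hr : 0 < r := by linarith [dist_nonneg (x := v) (y := u₀)]
  have hvr : v ∈ Metric.ball u₀ r := Metric.ball_subset_ball (by linarith) hv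
  -- In dimension zero there is no point at distance `√ε`, but all points coincide and `K 0` is the
  -- bound.
  rcases Nat.eq_zero_or_pos d with rfl | hd
  · refine ⟨v, fun u _ => by rwa [Subsingleton.elim u v], fun u _ => ?_⟩
    rw [Subsingleton.elim u v]
    simpa [kernelAt] using hk0
  · have : Nonempty (Fin d) := ⟨⟨0, hd⟩⟩
    obtain ⟨e, he⟩ := exists_norm_eq (EuclideanSpace ℝ (Fin d)) zero_le_one
    have hseg : ∀ t ∈ Set.Icc 0 (1 / m * √ε), v + t • e ∈ Metric.ball u₀ r := fun t ht => by
      rw [Metric.mem_ball]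
      have h1 : dist (v + t • e) v = t := by
        rw [dist_eq_norm, add_sub_cancel_left, norm_smul, he, mul_one, Real.norm_of_nonneg ht.1]
      have := dist_triangle (v + t • e) v u₀
      nlinarith [ht.2]
    have hFc : ContinuousOn F (Metric.ball u₀ r) :=
      (LipschitzOnWith.of_dist_le_mul (K := L.toNNReal) fun x hx y hy => by
        rw [dist_eq_norm, dist_eq_norm, Real.coe_toNNReal _ hL.le]
        exact (hF x hx y hy).1).continuousOn
    have hgc : ContinuousOn (fun t : ℝ => ‖F v - F (v + t • e)‖) (Set.Icc 0 (1 / m * √ε)) :=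
      (continuousOn_const.sub (hFc.comp (by fun_prop) hseg)).norm
    have hend : √ε ≤ ‖F v - F (v + (1 / m * √ε) • e)‖ := by
      have h1 := (hF v hvr _ (hseg _ ⟨by positivity, le_rfl⟩)).2
      rw [sub_add_cancel_left, norm_neg, norm_smul, he, mul_one,
        Real.norm_of_nonneg (by positivity)] at h1
      refine le_trans (le_of_eq ?_) h1
      field_simp
    -- Moving away from `v` along a segment, the image distance passes through exactly `√ε`. Around
    -- that point a ball of radius `(η / L) √ε` changes the distance by at most `η √ε`.
    obtain ⟨t, ht, hgt⟩ := intermediate_value_Icc (by positivity) hgc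
      (show √ε ∈ Set.Icc _ _ from ⟨by simp, hend⟩)
    have hwd : dist (v + t • e) u₀ < r - η / L * √ε := by
      have h1 : dist (v + t • e) v = t := by
        rw [dist_eq_norm, add_sub_cancel_left, norm_smul, he, mul_one, Real.norm_of_nonneg ht.1]
      have := dist_triangle (v + t • e) v u₀
      nlinarith [ht.2]
    have hsub : Metric.ball (v + t • e) (η / L * √ε) ⊆ Metric.ball u₀ r :=
      Metric.ball_subset_ball' (by linarith)
    refine ⟨v + t • e, hsub, fun u hu => ?_⟩
    have h1 := (hF _ (hseg t ht) u (hsub hu)).1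
    have h2 : ‖v + t • e - u‖ < η / L * √ε := by
      rw [← dist_eq_norm, dist_comm]
      exact hu
    have h3 : |‖F v - F u‖ - √ε| ≤ η * √ε := by
      have hgt' : ‖F v - F (v + t • e)‖ = √ε := hgt
      rw [← hgt']
      refine (abs_norm_sub_norm_le _ _).trans ?_
      rw [hgt', sub_sub_sub_cancel_left]
      refine h1.trans ((mul_le_mul_of_nonneg_left h2.le hL.le).trans_eq ?_)
      field_simp
    have h4 : |‖F v - F u‖ / √ε - 1| ≤ η := by
      have h5 : ‖F v - F u‖ / √ε - 1 = (‖F v - F u‖ - √ε) / √ε := by field_simp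
      rw [h5, abs_div, abs_of_pos hs, div_le_iff₀ hs]
      exact h3
    have h6 := hk1 _ h4
    rwa [div_pow, Real.sq_sqrt hε.le] at h6

variable {d q : ℕ} {M : Type*} [TopologicalSpace M]
  [ChartedSpace (EuclideanSpace ℝ (Fin d)) M] [IsManifold (𝓡 d) ∞ M]
  [MeasurableSpace M] [BorelSpace M]

theorem ofReal_mul_volume_le_chartVolume (g : Bundle.ContMDiffRiemannianMetric (𝓡 d) ∞
      (EuclideanSpace ℝ (Fin d)) (fun x : M => TangentSpace (𝓡 d) x)) (c : M)
    {b : ℝ} {s : Set (EuclideanSpace ℝ (Fin d))} (hs : MeasurableSet s)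
    (hst : s ⊆ (extChartAt (𝓡 d) c).target)
    (hb : ∀ u ∈ s, b ≤ √(chartGram g c u).det) {A : Set M} (hA : MeasurableSet A)
    (hsA : s ⊆ (extChartAt (𝓡 d) c).symm ⁻¹' A) :
    ENNReal.ofReal b * volume s ≤ chartVolume g c A := by
  have hae : AEMeasurable (extChartAt (𝓡 d) c).symm
      (((volume : Measure (EuclideanSpace ℝ (Fin d))).restrict
        (extChartAt (𝓡 d) c).target).withDensity
        fun u => ENNReal.ofReal (Real.sqrt (chartGram g c u).det)) :=
    ((continuousOn_extChartAt_symm c).aemeasurable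
      (isOpen_extChartAt_target c).measurableSet).mono_ac (withDensity_absolutelyContinuous _ _)
  rw [chartVolume, Measure.map_apply_of_aemeasurable hae hA]
  refine le_trans ?_ (measure_mono hsA)
  rw [withDensity_apply _ hs, Measure.restrict_restrict hs, Set.inter_eq_left.2 hst]
  rw [← setLIntegral_const]
  exact setLIntegral_mono' hs fun u hu => ENNReal.ofReal_le_ofReal (hb u hu)

/-- The set where the kernel is at least `k₀` contains the chart image of a ball of radius
comparable to `√ε`. Its measure is thus at least a constant times `ε ^ (d / 2)`, and Markov's
inequality transfers this to the integral. -/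
theorem exists_nhds_le_integral_kernelAt {K : ℝ → ℝ} (hK : IsAdmissibleKernel d K)
    (g : Bundle.ContMDiffRiemannianMetric (𝓡 d) ∞ (EuclideanSpace ℝ (Fin d))
      (fun x : M => TangentSpace (𝓡 d) x))
    {μ : Measure M} [IsProbabilityMeasure μ] {δ : ℝ} (hδ : 0 < δ)
    (hμ : ∀ A, MeasurableSet A → ENNReal.ofReal δ * riemannianVolume g A ≤ μ A)
    {f : M → EuclideanSpace ℝ (Fin q)}
    (hf : Manifold.IsSmoothEmbedding (𝓡 d) 𝓘(ℝ, EuclideanSpace ℝ (Fin q)) ∞ f) (c : M) :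
    ∃ U ∈ 𝓝 c, ∃ a > 0, ∃ ε₀ > 0, ∀ x ∈ U, ∀ ε : ℝ, 0 < ε → ε ≤ ε₀ →
      a * ε ^ ((d : ℝ) / 2) ≤ ∫ y, kernelAt K ε (f x) (f y) ∂μ := by
  obtain ⟨k₀, hk₀, hk0, η, hη, hk1⟩ := hK.exists_pos_le
  obtain ⟨B, hB⟩ := hK.bounded
  obtain ⟨L, hL, m, hm, hLip⟩ := exists_biLipschitz_chart (hf.isImmersion.isImmersionAt c)
  obtain ⟨b, hb, hgram⟩ := exists_le_sqrt_det_chartGram g c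
  set φ := extChartAt (𝓡 d) c with hφ
  obtain ⟨r₁, hr₁, hball⟩ := Metric.eventually_nhds_iff_ball.1
    (hgram.and ((isOpen_extChartAt_target c).mem_nhds (mem_extChartAt_target (I := 𝓡 d) c)))
  obtain ⟨r, hrL, hr⟩ := (hLip.and (Ioo_mem_nhdsGT hr₁)).exists
  set V := (volume (Metric.ball (0 : EuclideanSpace ℝ (Fin d)) 1)).toReal with hV
  have hV0 : 0 < V := ENNReal.toReal_pos (Metric.measure_ball_pos _ _ one_pos).ne'
    measure_ball_lt_top.ne
  -- The last halving turns the bound `r / 2` into `r / 4` and so makes the required inequality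
  -- strict.
  set s := r / 2 / (1 / m + η / L) / 2 with hs
  have hs0 : 0 < s := by have := hr.1; positivity
  have hU : φ.source ∩ φ ⁻¹' Metric.ball (φ c) (r / 2) ∈ 𝓝 c :=
    inter_mem (extChartAt_source_mem_nhds c)
      ((continuousAt_extChartAt c).preimage_mem_nhds (Metric.ball_mem_nhds _ (half_pos hr.1)))
  refine ⟨_, hU, k₀ * (δ * b * (η / L) ^ d * V), by positivity, s ^ 2, by positivity,
    fun x hx ε hε hεs => ?_⟩
  have hsε : √ε ≤ s := by
    rw [← Real.sqrt_sq hs0.le]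
    exact Real.sqrt_le_sqrt hεs
  have hεr : (1 / m + η / L) * √ε < r / 2 := by
    have h1 : (1 / m + η / L) * s = r / 2 / 2 := by rw [hs]; field_simp
    have h2 : (1 / m + η / L) * √ε ≤ (1 / m + η / L) * s :=
      mul_le_mul_of_nonneg_left hsε (by positivity)
    linarith [hr.1]
  obtain ⟨w, hw, hwk⟩ := exists_ball_le_kernelAt (F := fun u => f (φ.symm u)) hη hk0 hk1 hL hm hrL
    hε hεr hx.2
  simp only [φ.left_inv hx.1] at hwk
  have hfm : Measurable f := hf.isEmbedding.continuous.measurable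
  have hkm : Measurable fun y => kernelAt K ε (f x) (f y) :=
    hK.measurable_kernelAt hε measurable_const hfm
  set A : Set M := {y | k₀ ≤ kernelAt K ε (f x) (f y)} with hA
  have hAm : MeasurableSet A := measurableSet_le measurable_const hkm
  have hvol := ofReal_mul_volume_le_chartVolume g c (b := b) Metric.isOpen_ball.measurableSet
    (fun u hu => (hball u (Metric.ball_subset_ball hr.2.le (hw hu))).2)
    (fun u hu => (hball u (Metric.ball_subset_ball hr.2.le (hw hu))).1) hAm hwk
  have hchart : chartVolume g c A ≤ riemannianVolume g A :=
    Measure.le_iff'.1 (le_iSup (fun c => chartVolume g c) c) A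
  have hrad : 0 < η / L * √ε := by positivity
  have hμA : δ * b * (η / L) ^ d * V * ε ^ ((d : ℝ) / 2) ≤ μ.real A := by
    have h1 : ENNReal.ofReal δ * (ENNReal.ofReal b * volume (Metric.ball w (η / L * √ε))) ≤ μ A :=
      (mul_le_mul_right (hvol.trans hchart) _).trans (hμ A hAm)
    rw [Measure.addHaar_ball_of_pos _ _ hrad] at h1
    have h2 := ENNReal.toReal_mono (measure_ne_top μ A) h1
    simp only [ENNReal.toReal_mul, ENNReal.toReal_ofReal hδ.le, ENNReal.toReal_ofReal hb.le,
      finrank_euclideanSpace, Fintype.card_fin] at h2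
    rw [ENNReal.toReal_ofReal (by positivity), mul_pow] at h2
    have h3 : √ε ^ d = ε ^ ((d : ℝ) / 2) := by
      rw [Real.sqrt_eq_rpow, ← Real.rpow_natCast, ← Real.rpow_mul hε.le]
      congr 1
      ring
    rw [h3] at h2
    refine le_trans (le_of_eq ?_) h2
    ring
  have hk0' : ∀ y, 0 ≤ kernelAt K ε (f x) (f y) := fun y => hK.nonneg _ (by positivity)
  have hki : Integrable (fun y => kernelAt K ε (f x) (f y)) μ :=
    integrable_of_abs_le_const hkm fun y => by
      rw [abs_of_nonneg (hk0' y)]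
      exact hB _ (by positivity)
  have hmarkov := mul_meas_ge_le_integral_of_nonneg (ae_of_all _ hk0') hki k₀
  calc _ = k₀ * (δ * b * (η / L) ^ d * V * ε ^ ((d : ℝ) / 2)) := by ring
    _ ≤ k₀ * μ.real A := mul_le_mul_of_nonneg_left hμA hk₀.le
    _ ≤ _ := hmarkov

/-- The kernel averages are at least of order `ε ^ (d / 2)`, uniformly in the base point. -/
theorem exists_le_integral_kernelAt [CompactSpace M] {K : ℝ → ℝ} (hK : IsAdmissibleKernel d K)
    (g : Bundle.ContMDiffRiemannianMetric (𝓡 d) ∞ (EuclideanSpace ℝ (Fin d))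
      (fun x : M => TangentSpace (𝓡 d) x))
    {μ : Measure M} [IsProbabilityMeasure μ] {δ : ℝ} (hδ : 0 < δ)
    (hμ : ∀ A, MeasurableSet A → ENNReal.ofReal δ * riemannianVolume g A ≤ μ A)
    {f : M → EuclideanSpace ℝ (Fin q)}
    (hf : Manifold.IsSmoothEmbedding (𝓡 d) 𝓘(ℝ, EuclideanSpace ℝ (Fin q)) ∞ f) :
    ∃ a > 0, ∃ ε₀ > 0, ∀ x : M, ∀ ε : ℝ, 0 < ε → ε ≤ ε₀ →
      a * ε ^ ((d : ℝ) / 2) ≤ ∫ y, kernelAt K ε (f x) (f y) ∂μ := by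
  have h := isCompact_univ.induction_on (X := M)
    (p := fun U => ∃ a > 0, ∃ ε₀ > 0, ∀ x ∈ U, ∀ ε : ℝ, 0 < ε → ε ≤ ε₀ →
      a * ε ^ ((d : ℝ) / 2) ≤ ∫ y, kernelAt K ε (f x) (f y) ∂μ)
    ⟨1, one_pos, 1, one_pos, fun x hx => hx.elim⟩
    (fun s t hst ⟨a, ha, e, he, h⟩ => ⟨a, ha, e, he, fun x hx => h x (hst hx)⟩)
    (fun s t ⟨a, ha, e, he, h⟩ ⟨a', ha', e', he', h'⟩ =>
      ⟨min a a', lt_min ha ha', min e e', lt_min he he', fun x hx ε hε hεe => by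
        have hp : 0 ≤ ε ^ ((d : ℝ) / 2) := by positivity
        rcases hx with hx | hx
        · exact (mul_le_mul_of_nonneg_right (min_le_left _ _) hp).trans
            (h x hx ε hε (hεe.trans (min_le_left _ _)))
        · exact (mul_le_mul_of_nonneg_right (min_le_right _ _) hp).trans
            (h' x hx ε hε (hεe.trans (min_le_right _ _)))⟩)
    (fun c _ => by
      obtain ⟨U, hU, h⟩ := exists_nhds_le_integral_kernelAt hK g hδ hμ hf c
      exact ⟨U, mem_nhdsWithin_of_mem_nhds hU, h⟩)
  obtain ⟨a, ha, e, he, h⟩ := h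
  exact ⟨a, ha, e, he, fun x => h x trivial⟩

end KernelLowerBound

/-! ### Deterministic error propagation through weighted sums and quotients. -/

section RatioError

theorem abs_div_sub_div_le {N D N₁ D₁ C θ : ℝ} (hD : 0 ≤ D) (hC : 0 ≤ C) (hN : |N| ≤ C * D)
    (hD₁ : 0 < D₁) (h1 : |N - N₁| ≤ θ * D₁) (h2 : |D - D₁| ≤ θ * D₁) :
    |N / D - N₁ / D₁| ≤ (1 + C) * θ := by
  -- This also holds for `D = 0`, where `hN` forces `N = 0`; hence no lower bound on `D` is needed.
  have hND : N = N / D * D := by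
    rcases hD.eq_or_lt with h | h
    · rw [← h, mul_zero, abs_nonpos_iff] at hN
      simp [hN]
    · field_simp
  have hq : |N / D| ≤ C := by
    rw [abs_div, abs_of_nonneg hD]
    exact div_le_of_le_mul₀ hD hC hN
  -- In this splitting only `D₁` is divided by, and the coefficient `N / D` is bounded by `C`.
  have hsplit : N / D - N₁ / D₁ = ((N - N₁) - N / D * (D - D₁)) / D₁ := by
    rw [mul_sub, ← hND]
    field_simp
    ring
  rw [hsplit, abs_div, abs_of_pos hD₁, div_le_iff₀ hD₁]
  calc |N - N₁ - N / D * (D - D₁)| ≤ |N - N₁| + |N / D| * |D - D₁| := by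
        rw [← abs_mul]
        exact abs_sub _ _
    _ ≤ θ * D₁ + C * (θ * D₁) := add_le_add h1 (mul_le_mul hq h2 (abs_nonneg _) hC)
    _ = _ := by ring

/-- Inner sums are replaced by their means first, the outer sum by its mean afterwards. The first
replacement costs a multiple of the weighted sum of the `h j k`, which is still empirical; `hD`
compares it with `D` and gives the factor `1 + σ`. -/
theorem abs_weighted_sum_sub_le {β γ : Type*} [Fintype γ] (s : Finset β) {n : ℝ} (hn : 0 ≤ n)
    {w : γ → ℝ} (hw : ∀ k, 0 ≤ w k) {T h H : β → γ → ℝ} (hh : ∀ j k, 0 ≤ h j k)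
    {τ : β → ℝ} (hτ : ∀ j, 0 ≤ τ j) {σ N D : ℝ}
    (hT : ∀ j ∈ s, ∀ k, |T j k - n * H j k| ≤ τ j * (n * h j k))
    (hN : |∑ k, w k * ∑ j ∈ s, H j k - n * N| ≤ σ * (n * D))
    (hD : |∑ k, w k * ∑ j ∈ s, h j k - n * D| ≤ σ * (n * D)) :
    |∑ k, w k * ∑ j ∈ s, T j k - n ^ 2 * N| ≤
      ((∑ j ∈ s, τ j) * (1 + σ) + σ) * (n ^ 2 * D) := by
  set τs := ∑ j ∈ s, τ j with hτs
  have hτ0 : 0 ≤ τs := Finset.sum_nonneg fun j _ => hτ j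
  have hinner : ∀ k, |∑ j ∈ s, T j k - n * ∑ j ∈ s, H j k| ≤ τs * (n * ∑ j ∈ s, h j k) := by
    intro k
    rw [Finset.mul_sum, ← Finset.sum_sub_distrib]
    refine (Finset.abs_sum_le_sum_abs _ _).trans ?_
    rw [Finset.mul_sum, Finset.mul_sum]
    refine Finset.sum_le_sum fun j hj => (hT j hj k).trans ?_
    exact mul_le_mul_of_nonneg_right (Finset.single_le_sum (fun i _ => hτ i) hj)
      (mul_nonneg hn (hh j k))
  have hfirst : |∑ k, w k * ∑ j ∈ s, T j k - n * ∑ k, w k * ∑ j ∈ s, H j k| ≤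
      τs * (n * ∑ k, w k * ∑ j ∈ s, h j k) := by
    have h1 : ∑ k, w k * ∑ j ∈ s, T j k - n * ∑ k, w k * ∑ j ∈ s, H j k =
        ∑ k, w k * (∑ j ∈ s, T j k - n * ∑ j ∈ s, H j k) := by
      rw [Finset.mul_sum, ← Finset.sum_sub_distrib]
      exact Finset.sum_congr rfl fun _ _ => by ring
    have h2 : τs * (n * ∑ k, w k * ∑ j ∈ s, h j k) =
        ∑ k, w k * (τs * (n * ∑ j ∈ s, h j k)) := by
      rw [Finset.mul_sum, Finset.mul_sum]
      exact Finset.sum_congr rfl fun _ _ => by ring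
    rw [h1, h2]
    refine (Finset.abs_sum_le_sum_abs _ _).trans (Finset.sum_le_sum fun k _ => ?_)
    rw [abs_mul, abs_of_nonneg (hw k)]
    exact mul_le_mul_of_nonneg_left (hinner k) (hw k)
  have hD' : ∑ k, w k * ∑ j ∈ s, h j k ≤ (1 + σ) * (n * D) := by
    linarith [(abs_le.1 hD).2]
  calc |∑ k, w k * ∑ j ∈ s, T j k - n ^ 2 * N|
      = |(∑ k, w k * ∑ j ∈ s, T j k - n * ∑ k, w k * ∑ j ∈ s, H j k) +
          n * (∑ k, w k * ∑ j ∈ s, H j k - n * N)| := by congr 1; ring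
    _ ≤ τs * (n * ∑ k, w k * ∑ j ∈ s, h j k) + n * (σ * (n * D)) := by
        refine (abs_add_le _ _).trans (add_le_add hfirst ?_)
        rw [abs_mul, abs_of_nonneg hn]
        exact mul_le_mul_of_nonneg_left hN hn
    _ ≤ τs * (n * ((1 + σ) * (n * D))) + n * (σ * (n * D)) := by gcongr
    _ = _ := by ring

/-- Turns a deviation of size `√(n h)` into a relative error of `n h`, using just a lower bound for
`h`. -/
theorem sqrt_mul_le_of_le {n h a : ℝ} (hn : 0 < n) (ha : 0 < a) (hah : a ≤ h) :
    √(n * h) ≤ 1 / √(n * a) * (n * h) := by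
  have hh : 0 ≤ n * h := by have := ha.le.trans hah; positivity
  have h1 : √(n * a) ≤ √(n * h) := Real.sqrt_le_sqrt (by gcongr)
  have h2 : 0 < √(n * a) := by positivity
  rw [one_div, inv_mul_eq_div, le_div_iff₀ h2]
  calc √(n * h) * √(n * a) ≤ √(n * h) * √(n * h) := by gcongr
    _ = n * h := Real.mul_self_sqrt hh

end RatioError

/-! ### Relative concentration of the two-layer empirical sums. -/

section Fluctuation

variable {M : Type*} [MeasurableSpace M] {κ : ℕ}

/-- The average of `F` against the kernel `k` at the point `w`. -/
noncomputable def kernelMean (μ : Measure M) (k : M → M → ℝ) (F : M → ℝ) (w : M) : ℝ :=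
  ∫ v, k w v * F v ∂μ

/-- The double average `∑_{j ≠ ℓ} ∫∫ k_ℓ(w, u) k_j(u, v) F_j(v)`. -/
noncomputable def transferMean (μ : Measure M) (k : Fin κ → M → M → ℝ) (F : Fin κ → M → ℝ)
    (ℓ : Fin κ) (w : M) : ℝ :=
  ∫ u, k ℓ w u * ∑ j ∈ Finset.univ.erase ℓ, kernelMean μ (k j) (F j) u ∂μ

/-- The empirical counterpart of `transferMean`, without normalization. -/
noncomputable def transferSum {n : ℕ} (k : Fin κ → M → M → ℝ) (F : Fin κ → M → ℝ)
    (ℓ : Fin κ) (z : Fin n → M) (w : M) : ℝ :=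
  ∑ i, k ℓ w (z i) * ∑ j ∈ Finset.univ.erase ℓ, ∑ m, k j (z i) (z m) * F j (z m)

theorem measurable_kernelMean {μ : Measure M} [SFinite μ] {k : M → M → ℝ} {F : M → ℝ}
    (hk : Measurable (Function.uncurry k)) (hF : Measurable F) : Measurable (kernelMean μ k F) := by
  have h : Measurable (Function.uncurry fun w v => k w v * F v) :=
    hk.mul (hF.comp measurable_snd)
  exact (h.stronglyMeasurable.integral_prod_right (ν := μ)).measurable

theorem abs_kernelMean_le {μ : Measure M} [IsFiniteMeasure μ] {k : M → M → ℝ} {F : M → ℝ}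
    (hk : Measurable (Function.uncurry k)) {B C : ℝ}
    (hk0 : ∀ w v, 0 ≤ k w v) (hkB : ∀ w v, k w v ≤ B) (hFC : ∀ v, |F v| ≤ C) (w : M) :
    |kernelMean μ k F w| ≤ C * kernelMean μ k 1 w := by
  have hki : Integrable (k w) μ := integrable_of_abs_le_const (hk.comp measurable_prodMk_left)
    (B := B) fun v => (abs_of_nonneg (hk0 w v)).trans_le (hkB w v)
  have h1 : C * kernelMean μ k 1 w = ∫ v, k w v * C ∂μ := by
    simp only [kernelMean, Pi.one_apply, mul_one]
    rw [integral_mul_const, mul_comm]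
  rw [h1]
  rw [← Real.norm_eq_abs]
  refine norm_integral_le_of_norm_le (hki.mul_const C) (ae_of_all _ fun v => ?_)
  rw [norm_mul, Real.norm_of_nonneg (hk0 w v)]
  exact mul_le_mul_of_nonneg_left (hFC v) (hk0 w v)

theorem kernelMean_one_le {μ : Measure M} [IsProbabilityMeasure μ] {k : M → M → ℝ} {B : ℝ}
    (hk0 : ∀ w v, 0 ≤ k w v) (hkB : ∀ w v, k w v ≤ B) (w : M) : kernelMean μ k 1 w ≤ B := by
  have h := norm_integral_le_of_norm_le_const (μ := μ) (f := k w) (C := B)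
    (ae_of_all _ fun v => by rw [Real.norm_of_nonneg (hk0 w v)]; exact hkB w v)
  simp only [kernelMean, Pi.one_apply, mul_one]
  simpa using (le_abs_self _).trans h

theorem kernelMean_one_nonneg {μ : Measure M} {k : M → M → ℝ}
    (hk0 : ∀ w v, 0 ≤ k w v) (w : M) : 0 ≤ kernelMean μ k 1 w :=
  integral_nonneg fun v => by simpa using hk0 w v

variable {μ : Measure M} [IsProbabilityMeasure μ] {k : Fin κ → M → M → ℝ} {B : ℝ}

/-- All terms are nonnegative, so one view `j₀` may be kept: its inner mean is at least `a j₀`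
everywhere, and the outer kernel has mass at least `a ℓ`. -/
theorem le_transferMean_one (hk : ∀ j, Measurable (Function.uncurry (k j)))
    (hk0 : ∀ j w v, 0 ≤ k j w v) (hkB : ∀ j w v, k j w v ≤ B) {a : Fin κ → ℝ}
    (ha : ∀ j, 0 < a j) (hka : ∀ j w, a j ≤ kernelMean μ (k j) 1 w) {ℓ j₀ : Fin κ}
    (hj₀ : j₀ ≠ ℓ) (w : M) : a ℓ * a j₀ ≤ transferMean μ k 1 ℓ w := by
  have hB : 0 ≤ B := (hk0 ℓ w w).trans (hkB ℓ w w)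
  have hkm : Measurable (k ℓ w) := (hk ℓ).comp measurable_prodMk_left
  have hsm : Measurable fun u => ∑ j ∈ Finset.univ.erase ℓ, kernelMean μ (k j) 1 u :=
    Finset.measurable_sum _ fun j _ => measurable_kernelMean (hk j) measurable_one
  have hs0 : ∀ u, 0 ≤ ∑ j ∈ Finset.univ.erase ℓ, kernelMean μ (k j) 1 u := fun u =>
    Finset.sum_nonneg fun j _ => kernelMean_one_nonneg (hk0 j) u
  have hsB : ∀ u, ∑ j ∈ Finset.univ.erase ℓ, kernelMean μ (k j) 1 u ≤
      ∑ _j ∈ Finset.univ.erase ℓ, B := fun u =>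
    Finset.sum_le_sum fun j _ => kernelMean_one_le (hk0 j) (hkB j) u
  calc a ℓ * a j₀ ≤ kernelMean μ (k ℓ) 1 w * a j₀ :=
        mul_le_mul_of_nonneg_right (hka ℓ w) (ha j₀).le
    _ = ∫ u, k ℓ w u * a j₀ ∂μ := by simp [kernelMean, integral_mul_const]
    _ ≤ _ := by
        refine integral_mono ((integrable_of_abs_le_const hkm (B := B) fun v => ?_).mul_const _)
          (integrable_of_abs_le_const (hkm.mul hsm)
            (B := B * ∑ _j ∈ Finset.univ.erase ℓ, B) fun v => ?_) fun u => ?_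
        · rw [abs_of_nonneg (hk0 ℓ w v)]
          exact hkB ℓ w v
        · refine (abs_of_nonneg (mul_nonneg (hk0 ℓ w v) (hs0 v))).trans_le ?_
          exact mul_le_mul (hkB ℓ w v) (hsB v) (hs0 v) hB
        · refine mul_le_mul_of_nonneg_left ?_ (hk0 ℓ w u)
          refine (hka j₀ u).trans ?_
          exact Finset.single_le_sum (f := fun j => kernelMean μ (k j) 1 u)
            (fun j _ => kernelMean_one_nonneg (hk0 j) u) (by simp [hj₀])

variable {S : Type*} [MeasurableSpace S] {P : Measure S} [IsProbabilityMeasure P]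
  {x : ℕ → S → M}

/-- Relative concentration of `transferSum` around `n² transferMean`. -/
theorem real_transferSum_sub_gt_le (hx_indep : iIndepFun x P) (hxm : ∀ i, AEMeasurable (x i) P)
    (hxl : ∀ i, P.map (x i) = μ) (hk : ∀ j, Measurable (Function.uncurry (k j)))
    (hB : 1 ≤ B) (hk0 : ∀ j w v, 0 ≤ k j w v) (hkB : ∀ j w v, k j w v ≤ B)
    {F : Fin κ → M → ℝ} (hF : ∀ j, Measurable (F j)) {C : ℝ} (hC : 1 ≤ C)
    (hFC : ∀ j v, |F j v| ≤ C) {a : Fin κ → ℝ}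
    (ha : ∀ j, 0 < a j) (hka : ∀ j w, a j ≤ kernelMean μ (k j) 1 w) {ℓ j₀ : Fin κ}
    (hj₀ : j₀ ≠ ℓ) {n : ℕ} (hn : 0 < n) (hna : ∀ j, j ≠ ℓ → 1 ≤ n * a j)
    (hnaa : 1 ≤ n * (a ℓ * a j₀)) {R : ℝ} (hR : 0 ≤ R) (i : Fin n)
    {ρ : ℝ} (hρ : ρ = C * (κ * B ^ 2) * (R + 2)) {θ : ℝ}
    (hθ : θ = (1 + ρ) * ρ * (∑ j ∈ Finset.univ.erase ℓ, 1 / √(n * a j) +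
      1 / √(n * (a ℓ * a j₀)))) :
    P.real {b | θ * ((n : ℝ) ^ 2 * transferMean μ k 1 ℓ (x i b)) <
      |transferSum k F ℓ (fun m : Fin n => x m b) (x i b) -
        (n : ℝ) ^ 2 * transferMean μ k F ℓ (x i b)|} ≤ (κ * n + 2) * (2 * Real.exp (1 - R)) := by
  classical
  have hκ : (1 : ℝ) ≤ κ := by exact_mod_cast (Fin.pos ℓ)
  have hC0 : 0 < C := by linarith
  have hn0 : (0 : ℝ) < n := by exact_mod_cast hn
  set e := Finset.univ.erase ℓ with he
  set q := 2 * Real.exp (1 - R) with hq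
  have hq0 : 0 ≤ q := by positivity
  have hκB : 1 ≤ κ * B ^ 2 := one_le_mul_of_one_le_of_one_le hκ (one_le_pow₀ hB)
  have hBκ : B ≤ κ * B ^ 2 := by nlinarith
  have hρ0 : 0 ≤ ρ := by rw [hρ]; positivity
  -- the inner sums
  have hin : ∀ j ∈ e, ∀ m : Fin n, P.real {b | C * B * √(n * kernelMean μ (k j) 1 (x m b)) *
      (R + 2) < |∑ l : Fin n, k j (x m b) (x l b) * F j (x l b) -
        n * kernelMean μ (k j) (F j) (x m b)|} ≤ q := fun j hj m => by
    have h := real_abs_sum_sub_gt_le (P := P) (μ := μ) hx_indep hxm hxl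
      (Y := fun w v => k j w v * F j v) (Φ := k j)
      ((hk j).mul ((hF j).comp measurable_snd)) (hk j) hC0 hB (hk0 j) (hkB j)
      (fun w v => by
        rw [abs_mul, abs_of_nonneg (hk0 j w v), mul_comm C]
        exact mul_le_mul_of_nonneg_left (hFC j v) (hk0 j w v)) (n := n)
      (fun w => by
        have h1 := hka j w
        simp only [kernelMean, Pi.one_apply, mul_one] at h1
        exact (hna j (Finset.ne_of_mem_erase hj)).trans (by gcongr)) R m
    simpa only [kernelMean, Pi.one_apply, mul_one] using h
  -- the outer sums
  have hout : ∀ G : Fin κ → M → ℝ, (∀ j, Measurable (G j)) → (∀ j v, |G j v| ≤ C) →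
      P.real {b | C * (κ * B ^ 2) * √(n * transferMean μ k 1 ℓ (x i b)) * (R + 2) <
        |∑ m : Fin n, k ℓ (x i b) (x m b) * ∑ j ∈ e, kernelMean μ (k j) (G j) (x m b) -
          n * transferMean μ k G ℓ (x i b)|} ≤ q := fun G hG hGC => by
    have hs0 : ∀ u, 0 ≤ ∑ j ∈ e, kernelMean μ (k j) 1 u := fun u =>
      Finset.sum_nonneg fun j _ => kernelMean_one_nonneg (hk0 j) u
    have hsB : ∀ u, ∑ j ∈ e, kernelMean μ (k j) 1 u ≤ κ * B := fun u => by
      calc _ ≤ ∑ _j ∈ e, B := Finset.sum_le_sum fun j _ => kernelMean_one_le (hk0 j) (hkB j) u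
        _ ≤ ∑ _j : Fin κ, B := Finset.sum_le_sum_of_subset_of_nonneg (Finset.subset_univ _)
            fun _ _ _ => by linarith
        _ = κ * B := by simp
    have hsm : ∀ G : Fin κ → M → ℝ, (∀ j, Measurable (G j)) → Measurable (Function.uncurry
        fun w v => k ℓ w v * ∑ j ∈ e, kernelMean μ (k j) (G j) v) := fun G hG =>
      (hk ℓ).mul ((Finset.measurable_sum e fun j _ =>
        measurable_kernelMean (hk j) (hG j)).comp measurable_snd)
    -- The inner means are deterministic functions of the intermediate point, so this is again a
    -- one-layer sum. Its majorant is the same expression with `G = 1`, bounded by `κ B²`.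
    exact real_abs_sum_sub_gt_le (P := P) (μ := μ) hx_indep hxm hxl
      (Y := fun w v => k ℓ w v * ∑ j ∈ e, kernelMean μ (k j) (G j) v)
      (Φ := fun w v => k ℓ w v * ∑ j ∈ e, kernelMean μ (k j) 1 v)
      (hsm G hG) (hsm 1 fun _ => measurable_one) hC0 hκB
      (fun w v => mul_nonneg (hk0 ℓ w v) (hs0 v))
      (fun w v => by
        calc _ ≤ B * (κ * B) := mul_le_mul (hkB ℓ w v) (hsB v) (hs0 v) (by linarith)
          _ = _ := by ring)
      (fun w v => by
        rw [abs_mul, abs_of_nonneg (hk0 ℓ w v), mul_left_comm, Finset.mul_sum]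
        refine mul_le_mul_of_nonneg_left ((Finset.abs_sum_le_sum_abs _ _).trans
          (Finset.sum_le_sum fun j _ => ?_)) (hk0 ℓ w v)
        exact abs_kernelMean_le (hk j) (hk0 j) (hkB j) (hGC j) v) (n := n)
      (fun w => hnaa.trans (mul_le_mul_of_nonneg_left
        (le_transferMean_one hk hk0 hkB ha hka hj₀ w) hn0.le)) R i
  have hoF := hout F hF hFC
  have ho1 := hout 1 (fun _ => measurable_one) (fun _ _ => by simpa using hC)
  set E : Fin κ → Fin n → Set S := fun j m =>
    {b | C * B * √(n * kernelMean μ (k j) 1 (x m b)) * (R + 2) <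
      |∑ l : Fin n, k j (x m b) (x l b) * F j (x l b) -
        n * kernelMean μ (k j) (F j) (x m b)|} with hE
  set O : (Fin κ → M → ℝ) → Set S := fun G =>
    {b | C * (κ * B ^ 2) * √(n * transferMean μ k 1 ℓ (x i b)) * (R + 2) <
        |∑ m : Fin n, k ℓ (x i b) (x m b) * ∑ j ∈ e, kernelMean μ (k j) (G j) (x m b) -
          n * transferMean μ k G ℓ (x i b)|} with hO
  have hsub : {b | θ * ((n : ℝ) ^ 2 * transferMean μ k 1 ℓ (x i b)) <
      |transferSum k F ℓ (fun m : Fin n => x m b) (x i b) -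
        (n : ℝ) ^ 2 * transferMean μ k F ℓ (x i b)|} ⊆
      (⋃ j ∈ e, ⋃ m ∈ (Finset.univ : Finset (Fin n)), E j m) ∪ (O F ∪ O 1) := by
    intro b hb
    by_contra hcon
    simp only [Set.mem_union, Set.mem_iUnion, not_or, not_exists, Finset.mem_univ]
      at hcon
    obtain ⟨hcE, hcF, hc1⟩ := hcon
    simp only [hO, Set.mem_ofPred_eq, not_lt] at hcF hc1
    have hD0 : a ℓ * a j₀ ≤ transferMean μ k 1 ℓ (x i b) :=
      le_transferMean_one hk hk0 hkB ha hka hj₀ (x i b)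
    have haa : 0 < a ℓ * a j₀ := mul_pos (ha ℓ) (ha j₀)
    set σ := ρ * (1 / √(n * (a ℓ * a j₀))) with hσ
    have hσρ : σ ≤ ρ := by
      refine mul_le_of_le_one_right hρ0 ?_
      rw [div_le_one (by positivity)]
      exact Real.one_le_sqrt.2 hnaa
    have hσ0 : 0 ≤ σ := by positivity
    have hconv : ∀ z : ℝ, z ≤ C * (κ * B ^ 2) * √(n * transferMean μ k 1 ℓ (x i b)) * (R + 2) →
        z ≤ σ * (n * transferMean μ k 1 ℓ (x i b)) := fun z hz => by
      refine hz.trans ?_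
      calc _ = ρ * √(n * transferMean μ k 1 ℓ (x i b)) := by rw [hρ]; ring
        _ ≤ ρ * (1 / √(n * (a ℓ * a j₀)) * (n * transferMean μ k 1 ℓ (x i b))) :=
          mul_le_mul_of_nonneg_left (sqrt_mul_le_of_le hn0 haa hD0) hρ0
        _ = _ := by rw [hσ]; ring
    have hmain := abs_weighted_sum_sub_le e hn0.le
      (w := fun m : Fin n => k ℓ (x i b) (x m b))
      (T := fun j m => ∑ l : Fin n, k j (x m b) (x l b) * F j (x l b))
      (h := fun j m => kernelMean μ (k j) 1 (x m b))
      (H := fun j m => kernelMean μ (k j) (F j) (x m b))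
      (τ := fun j => ρ * (1 / √(n * a j))) (σ := σ)
      (fun m => hk0 ℓ _ _) (fun j m => kernelMean_one_nonneg (hk0 j) _)
      (fun j => by positivity)
      (fun j hj m => by
        have h1 := hcE j hj m trivial
        simp only [hE, Set.mem_ofPred_eq, not_lt] at h1
        refine h1.trans ?_
        have h2 := sqrt_mul_le_of_le hn0 (ha j) (hka j (x m b))
        have h3 : C * B * (R + 2) ≤ ρ := by
          rw [hρ]
          gcongr
        calc _ = C * B * (R + 2) * √(n * kernelMean μ (k j) 1 (x m b)) := by ring
          _ ≤ ρ * (1 / √(n * a j) * (n * kernelMean μ (k j) 1 (x m b))) :=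
            mul_le_mul h3 h2 (Real.sqrt_nonneg _) hρ0
          _ = _ := by ring)
      (hconv _ hcF) (hconv _ hc1)
    have hD1 : 0 ≤ (n : ℝ) ^ 2 * transferMean μ k 1 ℓ (x i b) :=
      mul_nonneg (by positivity) (haa.le.trans hD0)
    have hτ0 : 0 ≤ ∑ j ∈ e, 1 / √(n * a j) := Finset.sum_nonneg fun j _ => by positivity
    -- Uses `σ ≤ ρ` in the product and the crude `σ ≤ (1 + ρ) σ` to reach a common prefactor.
    have hle : (∑ j ∈ e, ρ * (1 / √(n * a j))) * (1 + σ) + σ ≤ θ := by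
      rw [← Finset.mul_sum]
      calc _ ≤ ρ * (∑ j ∈ e, 1 / √(n * a j)) * (1 + ρ) + (1 + ρ) * σ := by
            gcongr
            nlinarith
        _ = θ := by rw [hθ, hσ]; ring
    exact absurd (hmain.trans (mul_le_mul_of_nonneg_right hle hD1)) (not_le.2 hb)
  have hunion : P.real (⋃ j ∈ e, ⋃ m ∈ (Finset.univ : Finset (Fin n)), E j m) ≤ κ * n * q := by
    refine (measureReal_biUnion_finset_le _ _).trans ?_
    calc _ ≤ ∑ _j ∈ e, (n : ℝ) * q := Finset.sum_le_sum fun j hj => by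
          refine (measureReal_biUnion_finset_le _ _).trans ?_
          refine (Finset.sum_le_sum fun m _ => hin j hj m).trans ?_
          simp
      _ ≤ ∑ _j : Fin κ, (n : ℝ) * q := Finset.sum_le_sum_of_subset_of_nonneg
          (Finset.subset_univ _) fun _ _ _ => by positivity
      _ = _ := by simp; ring
  refine (measureReal_mono hsub).trans ((measureReal_union_le _ _).trans ?_)
  linarith [measureReal_union_le (μ := P) (O F) (O 1)]

/-- Concentration of the ratio of the empirical averages around the ratio of the means. -/
theorem real_ratio_sub_gt_le (hx_indep : iIndepFun x P) (hxm : ∀ i, AEMeasurable (x i) P)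
    (hxl : ∀ i, P.map (x i) = μ) (hk : ∀ j, Measurable (Function.uncurry (k j)))
    (hB : 1 ≤ B) (hk0 : ∀ j w v, 0 ≤ k j w v) (hkB : ∀ j w v, k j w v ≤ B)
    {F : Fin κ → M → ℝ} (hF : ∀ j, Measurable (F j)) {C : ℝ} (hC : 1 ≤ C)
    (hFC : ∀ j v, |F j v| ≤ C) {a : Fin κ → ℝ}
    (ha : ∀ j, 0 < a j) (hka : ∀ j w, a j ≤ kernelMean μ (k j) 1 w) {ℓ j₀ : Fin κ}
    (hj₀ : j₀ ≠ ℓ) {n : ℕ} (hn : 0 < n) (hna : ∀ j, j ≠ ℓ → 1 ≤ n * a j)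
    (hnaa : 1 ≤ n * (a ℓ * a j₀)) {R : ℝ} (hR : 0 ≤ R) (i : Fin n)
    {ρ : ℝ} (hρ : ρ = C * (κ * B ^ 2) * (R + 2)) {θ : ℝ}
    (hθ : θ = (1 + ρ) * ρ * (∑ j ∈ Finset.univ.erase ℓ, 1 / √(n * a j) +
      1 / √(n * (a ℓ * a j₀)))) :
    P.real {b | (1 + C) * θ <
      |transferSum k F ℓ (fun m : Fin n => x m b) (x i b) /
          transferSum k 1 ℓ (fun m : Fin n => x m b) (x i b) -
        transferMean μ k F ℓ (x i b) / transferMean μ k 1 ℓ (x i b)|} ≤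
      (κ * n + 2) * (4 * Real.exp (1 - R)) := by
  have h1 := real_transferSum_sub_gt_le hx_indep hxm hxl hk hB hk0 hkB hF hC hFC ha hka hj₀ hn
    hna hnaa hR i hρ hθ
  have h2 := real_transferSum_sub_gt_le hx_indep hxm hxl hk hB hk0 hkB (F := 1)
    (fun _ => measurable_one) hC (fun _ _ => by simpa using hC) ha hka hj₀ hn hna hnaa hR i hρ hθ
  refine (measureReal_mono ?_ (measure_ne_top _ _)).trans ((measureReal_union_le _ _).trans
    ((add_le_add h1 h2).trans_eq (by ring)))
  intro b hb
  by_contra hcon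
  simp only [Set.mem_union, Set.mem_ofPred_eq, not_or, not_lt] at hcon
  rw [Set.mem_ofPred_eq] at hb
  refine absurd ?_ (not_le.2 hb)
  have hn0 : (0 : ℝ) < n := by exact_mod_cast hn
  have hD : 0 < transferMean μ k 1 ℓ (x i b) := (mul_pos (ha ℓ) (ha j₀)).trans_le
    (le_transferMean_one hk hk0 hkB ha hka hj₀ (x i b))
  have hdiv : transferMean μ k F ℓ (x i b) / transferMean μ k 1 ℓ (x i b) =
      ((n : ℝ) ^ 2 * transferMean μ k F ℓ (x i b)) /
        ((n : ℝ) ^ 2 * transferMean μ k 1 ℓ (x i b)) := by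
    rw [mul_div_mul_left _ _ (by positivity)]
  rw [hdiv]
  refine abs_div_sub_div_le ?_ (by linarith) ?_ (by positivity) hcon.1 hcon.2
  · exact Finset.sum_nonneg fun m _ => mul_nonneg (hk0 _ _ _) (Finset.sum_nonneg fun j _ =>
      Finset.sum_nonneg fun l _ => by simpa using hk0 j _ _)
  · unfold transferSum
    rw [Finset.mul_sum]
    refine (Finset.abs_sum_le_sum_abs _ _).trans (Finset.sum_le_sum fun m _ => ?_)
    rw [abs_mul, abs_of_nonneg (hk0 _ _ _), mul_left_comm]
    refine mul_le_mul_of_nonneg_left ?_ (hk0 _ _ _)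
    rw [Finset.mul_sum]
    refine (Finset.abs_sum_le_sum_abs _ _).trans (Finset.sum_le_sum fun j _ => ?_)
    rw [Finset.mul_sum]
    refine (Finset.abs_sum_le_sum_abs _ _).trans (Finset.sum_le_sum fun l _ => ?_)
    rw [abs_mul, abs_of_nonneg (hk0 _ _ _), Pi.one_apply, Pi.one_apply, mul_one, mul_comm C]
    exact mul_le_mul_of_nonneg_left (hFC j _) (hk0 _ _ _)

end Fluctuation

/-! ### Both sides of the comparison as ratios over the latent space. -/

section Reformulation

variable {M : Type*} {κ : ℕ} {p : Fin κ → ℕ}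

/-- The kernel of the `j`-th view, pulled back to the latent space. -/
noncomputable def latentKernel (K : ℝ → ℝ) (ε : Fin κ → ℝ)
    (ι : ∀ ℓ : Fin κ, M → EuclideanSpace ℝ (Fin (p ℓ))) (j : Fin κ) (u v : M) : ℝ :=
  kernelAt K (ε j) (ι j u) (ι j v)

theorem transfer_toView {ι : ∀ ℓ : Fin κ, M → EuclideanSpace ℝ (Fin (p ℓ))} {i : Fin κ}
    (hi : Function.Injective (ι i)) (j : Fin κ) (u : M) :
    transfer ι j i (toView ι i u) = toView ι j u := by
  unfold transfer
  congr 1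
  exact hi (Set.apply_rangeSplitting (ι i) (toView ι i u))

theorem sum_blockKernel_mul {K : ℝ → ℝ} {ε : Fin κ → ℝ}
    {ι : ∀ ℓ : Fin κ, M → EuclideanSpace ℝ (Fin (p ℓ))} {n : ℕ} (z : Fin n → M)
    (F : Fin κ → M → ℝ) (s : Fin κ × Fin n) :
    ∑ b, blockKernel (fun ℓ => kernelMatrix K (ε ℓ) fun i => ι ℓ (z i)) s b * F b.1 (z b.2) =
      transferSum (latentKernel K ε ι) F s.1 z (z s.2) := by
  classical
  rw [Fintype.sum_prod_type]
  have h1 : ∀ j, (∑ m, blockKernel (fun ℓ => kernelMatrix K (ε ℓ) fun i => ι ℓ (z i)) s (j, m) *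
      F j (z m)) = if j ∈ Finset.univ.erase s.1 then
        ∑ i, latentKernel K ε ι s.1 (z s.2) (z i) *
          ∑ m, latentKernel K ε ι j (z i) (z m) * F j (z m) else 0 := fun j => by
    by_cases h : s.1 = j
    · simp [blockKernel, h]
    · have h' : j ∈ Finset.univ.erase s.1 := by simp [Ne.symm h]
      simp only [h', if_true, blockKernel, Matrix.of_apply, h, if_false, Matrix.mul_apply,
        kernelMatrix, Finset.sum_mul, Finset.mul_sum]
      rw [Finset.sum_comm]
      exact Finset.sum_congr rfl fun _ _ => Finset.sum_congr rfl fun _ _ => by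
        rw [latentKernel, latentKernel, mul_assoc]
  simp_rw [h1]
  rw [Finset.sum_ite_mem, Finset.univ_inter]
  simp only [transferSum, Finset.mul_sum]
  rw [Finset.sum_comm]

/-- All degrees must be nonzero, not just that of row `s`: a single zero makes the diagonal matrix
singular, and its `⁻¹` would then be the zero matrix. -/
theorem cleanTransition_mulVec {K : ℝ → ℝ} {ε : Fin κ → ℝ}
    {ι : ∀ ℓ : Fin κ, M → EuclideanSpace ℝ (Fin (p ℓ))} {n : ℕ} (z : Fin n → M)
    (f : ∀ j : Fin κ, View ι j → ℝ)
    (hpos : ∀ s : Fin κ × Fin n, transferSum (latentKernel K ε ι) 1 s.1 z (z s.2) ≠ 0)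
    (s : Fin κ × Fin n) :
    ((cleanTransition K ε ι z).mulVec (discretize ι f z)) s =
      transferSum (latentKernel K ε ι) (fun j v => f j (toView ι j v)) s.1 z (z s.2) /
        transferSum (latentKernel K ε ι) 1 s.1 z (z s.2) := by
  have hdeg : ∀ s : Fin κ × Fin n,
      ∑ b, blockKernel (fun ℓ => kernelMatrix K (ε ℓ) fun i => ι ℓ (z i)) s b =
        transferSum (latentKernel K ε ι) 1 s.1 z (z s.2) := fun s => by
    rw [← sum_blockKernel_mul]
    simp
  have hinv : (degreeMatrix (blockKernel fun ℓ => kernelMatrix K (ε ℓ) fun i => ι ℓ (z i)))⁻¹ =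
      Matrix.diagonal fun s : Fin κ × Fin n =>
        (transferSum (latentKernel K ε ι) 1 s.1 z (z s.2))⁻¹ := by
    refine Matrix.inv_eq_right_inv ?_
    rw [degreeMatrix, Matrix.diagonal_mul_diagonal, ← Matrix.diagonal_one]
    congr 1
    funext s
    rw [hdeg, mul_inv_cancel₀ (hpos s)]
  rw [cleanTransition, transitionMatrix, hinv, ← Matrix.mulVec_mulVec, Matrix.mulVec_diagonal,
    inv_mul_eq_div,
    ← sum_blockKernel_mul z fun j v => f j (toView ι j v)]
  rfl

variable [TopologicalSpace M] [MeasurableSpace M] [BorelSpace M]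

theorem integral_viewLaw {ι : ∀ ℓ : Fin κ, M → EuclideanSpace ℝ (Fin (p ℓ))} {j : Fin κ}
    (hj : Topology.IsEmbedding (ι j)) (μ : Measure M) (G : View ι j → ℝ) :
    ∫ z, G z ∂(viewLaw ι μ j) = ∫ v, G (toView ι j v) ∂μ :=
  hj.toHomeomorph.measurableEmbedding.integral_map G

/-- Fubini for a bounded measurable integrand, after pulling both view laws back to `μ`. -/
theorem integral_transferKernel_mul {d : ℕ} {K : ℝ → ℝ} (hK : IsAdmissibleKernel d K)
    {ε : Fin κ → ℝ} (hε : ∀ j, 0 < ε j)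
    {ι : ∀ ℓ : Fin κ, M → EuclideanSpace ℝ (Fin (p ℓ))}
    (hι : ∀ j, Topology.IsEmbedding (ι j)) {μ : Measure M} [IsProbabilityMeasure μ]
    {i j : Fin κ} {h : View ι j → ℝ} (hh : Measurable fun v => h (toView ι j v)) {C : ℝ}
    (hC : ∀ v, |h (toView ι j v)| ≤ C) (x : M) :
    ∫ z, transferKernel K ε ι μ i j (toView ι i x) z * h z ∂(viewLaw ι μ j) =
      ∫ u, latentKernel K ε ι i x u *
        kernelMean μ (latentKernel K ε ι j) (fun v => h (toView ι j v)) u ∂μ := by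
  obtain ⟨B, hB⟩ := hK.bounded
  have hm : ∀ j, Measurable (ι j) := fun j => (hι j).continuous.measurable
  have hk0 : ∀ j u v, 0 ≤ latentKernel K ε ι j u v := fun j u v =>
    hK.nonneg _ (div_nonneg (sq_nonneg _) (hε j).le)
  have hkB : ∀ j u v, latentKernel K ε ι j u v ≤ B := fun j u v =>
    hB _ (div_nonneg (sq_nonneg _) (hε j).le)
  have hB0 : 0 ≤ B := (hk0 i x x).trans (hkB i x x)
  have hC0 : 0 ≤ C := (abs_nonneg _).trans (hC x)
  rw [integral_viewLaw (hι j)]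
  have h1 : ∀ v, transferKernel K ε ι μ i j (toView ι i x) (toView ι j v) * h (toView ι j v) =
      ∫ u, latentKernel K ε ι i x u * latentKernel K ε ι j u v * h (toView ι j v) ∂μ := fun v => by
    rw [transferKernel, integral_viewLaw (hι i), integral_mul_const]
    simp only [transfer_toView (hι i).injective]
    rfl
  have h2 : ∀ u, latentKernel K ε ι i x u *
        kernelMean μ (latentKernel K ε ι j) (fun v => h (toView ι j v)) u =
      ∫ v, latentKernel K ε ι i x u * latentKernel K ε ι j u v * h (toView ι j v) ∂μ := fun u => by
    rw [kernelMean, ← integral_const_mul]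
    simp only [mul_assoc]
  simp_rw [h1, h2]
  refine integral_integral_swap (integrable_of_abs_le_const ?_ (B := B * B * C) ?_)
  · exact ((hK.measurable_kernelAt (hε i) measurable_const ((hm i).comp measurable_snd)).mul
      (hK.measurable_kernelAt (hε j) ((hm j).comp measurable_snd)
        ((hm j).comp measurable_fst))).mul (hh.comp measurable_fst)
  · rintro ⟨v, u⟩
    simp only [Function.uncurry_apply_pair]
    rw [abs_mul, abs_mul, abs_of_nonneg (hk0 _ _ _), abs_of_nonneg (hk0 _ _ _)]
    exact mul_le_mul (mul_le_mul (hkB _ _ _) (hkB _ _ _) (hk0 _ _ _) hB0) (hC v)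
      (abs_nonneg _) (mul_nonneg hB0 hB0)

theorem measurable_latentKernel {d : ℕ} {K : ℝ → ℝ} (hK : IsAdmissibleKernel d K)
    {ε : Fin κ → ℝ} (hε : ∀ j, 0 < ε j)
    {ι : ∀ ℓ : Fin κ, M → EuclideanSpace ℝ (Fin (p ℓ))}
    (hι : ∀ j, Topology.IsEmbedding (ι j)) (j : Fin κ) :
    Measurable (Function.uncurry (latentKernel K ε ι j)) :=
  hK.measurable_kernelAt (hε j) ((hι j).continuous.measurable.comp measurable_fst)
    ((hι j).continuous.measurable.comp measurable_snd)

theorem limitOperator_toView {d : ℕ} {K : ℝ → ℝ} (hK : IsAdmissibleKernel d K)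
    {ε : Fin κ → ℝ} (hε : ∀ j, 0 < ε j)
    {ι : ∀ ℓ : Fin κ, M → EuclideanSpace ℝ (Fin (p ℓ))}
    (hι : ∀ j, Topology.IsEmbedding (ι j)) {μ : Measure M} [IsProbabilityMeasure μ]
    {f : ∀ j : Fin κ, View ι j → ℝ} (hf : ∀ j, Measurable fun v => f j (toView ι j v)) {C : ℝ}
    (hC : ∀ j v, |f j (toView ι j v)| ≤ C) (ℓ : Fin κ) (x : M) :
    limitOperator K ε ι μ f ℓ (toView ι ℓ x) =
      transferMean μ (latentKernel K ε ι) (fun j v => f j (toView ι j v)) ℓ x /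
        transferMean μ (latentKernel K ε ι) 1 ℓ x := by
  obtain ⟨B, hB⟩ := hK.bounded
  have hk0 : ∀ j u v, 0 ≤ latentKernel K ε ι j u v := fun j u v =>
    hK.nonneg _ (div_nonneg (sq_nonneg _) (hε j).le)
  have hkB : ∀ j u v, latentKernel K ε ι j u v ≤ B := fun j u v =>
    hB _ (div_nonneg (sq_nonneg _) (hε j).le)
  have hkm := measurable_latentKernel hK hε hι
  have hB0 : 0 ≤ B := (hk0 ℓ x x).trans (hkB ℓ x x)
  have hsum : ∀ (F : Fin κ → M → ℝ) (A : ℝ), (∀ j, Measurable (F j)) → (∀ j v, |F j v| ≤ A) →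
      transferMean μ (latentKernel K ε ι) F ℓ x = ∑ j ∈ Finset.univ.erase ℓ,
        ∫ u, latentKernel K ε ι ℓ x u * kernelMean μ (latentKernel K ε ι j) (F j) u ∂μ := by
    intro F A hF hA
    have hA0 : 0 ≤ A := (abs_nonneg _).trans (hA ℓ x)
    simp only [transferMean, Finset.mul_sum]
    refine integral_finsetSum _ fun j _ => ?_
    refine integrable_of_abs_le_const (((hkm ℓ).comp measurable_prodMk_left).mul
      (measurable_kernelMean (hkm j) (hF j))) (B := B * (A * B)) fun u => ?_
    change |latentKernel K ε ι ℓ x u * _| ≤ _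
    rw [abs_mul, abs_of_nonneg (hk0 _ _ _)]
    refine mul_le_mul (hkB _ _ _) ?_ (abs_nonneg _) hB0
    exact (abs_kernelMean_le (hkm j) (hk0 j) (hkB j) (hA j) u).trans
      (mul_le_mul_of_nonneg_left (kernelMean_one_le (hk0 j) (hkB j) u) hA0)
  rw [hsum _ C hf hC, hsum 1 1 (fun _ => measurable_one) (fun _ _ => by simp)]
  simp only [limitOperator, viewOperator]
  rw [← Finset.sum_div]
  congr 1
  · exact Finset.sum_congr rfl fun j _ =>
      integral_transferKernel_mul hK hε hι (hf j) (hC j) x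
  · refine Finset.sum_congr rfl fun j _ => ?_
    have h := integral_transferKernel_mul hK hε hι (μ := μ) (i := ℓ) (j := j) (h := fun _ => 1)
      measurable_const (C := 1) (fun _ => by simp) x
    simp only [mul_one] at h
    exact h

end Reformulation

/-! ### Comparison of rates and asymptotic absorption of constants. -/

section Asymptotics

/-- Read with `q = ε_ℓ ^ (d/4)` and `t = ε_j ^ (d/4)`. After squaring, the two comparisons lose the
factors `c q² t²` and `t²`, both at most `1`. -/
theorem one_div_sqrt_le {n c q t : ℝ} (hn : 0 < n) (hc : 0 < c) (hc1 : c ≤ 1) (hq : 0 < q)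
    (hq1 : q ≤ 1) (ht : 0 < t) (ht1 : t ≤ 1) :
    1 / √(n * (c * t ^ 2)) ≤ c⁻¹ * (1 / (√n * q * t ^ 2)) ∧
    1 / √(n * (c * q ^ 2 * (c * t ^ 2))) ≤ c⁻¹ * (1 / (√n * q * t ^ 2)) := by
  have hs : 0 < √n := Real.sqrt_pos.2 hn
  have hrw : c⁻¹ * (1 / (√n * q * t ^ 2)) = 1 / (c * (√n * q * t ^ 2)) := by
    field_simp
  rw [hrw]
  have hsq : (c * (√n * q * t ^ 2)) ^ 2 = n * (c * t ^ 2) * (c * q ^ 2 * t ^ 2) := by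
    rw [mul_pow, mul_pow, mul_pow, Real.sq_sqrt hn.le]
    ring
  have hq2 : q ^ 2 ≤ 1 := pow_le_one₀ hq.le hq1
  have ht2 : t ^ 2 ≤ 1 := pow_le_one₀ ht.le ht1
  constructor
  · refine one_div_le_one_div_of_le (by positivity) (Real.le_sqrt_of_sq_le ?_)
    rw [hsq]
    refine mul_le_of_le_one_right (by positivity) ?_
    exact mul_le_one₀ (mul_le_one₀ hc1 (by positivity) hq2) (by positivity) ht2
  · refine one_div_le_one_div_of_le (by positivity) (Real.le_sqrt_of_sq_le ?_)
    rw [hsq]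
    have h : n * (c * q ^ 2 * (c * t ^ 2)) = n * (c * t ^ 2) * (c * q ^ 2) := by ring
    rw [h]
    exact mul_le_mul_of_nonneg_left (mul_le_of_le_one_right (by positivity) ht2) (by positivity)

theorem eventually_polynomial_mul_exp_le (A : ℝ) {υ : ℝ} (hυ : 0 < υ) (D : ℝ) :
    ∀ᶠ n : ℕ in atTop, (A * n + 2) * (4 * Real.exp (1 - (n : ℝ) ^ υ)) ≤ (n : ℝ) ^ (-D) := by
  have hcast : Tendsto (fun n : ℕ => (n : ℝ)) atTop atTop := tendsto_natCast_atTop_atTop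
  have hy : Tendsto (fun n : ℕ => (n : ℝ) ^ υ) atTop atTop :=
    (tendsto_rpow_atTop hυ).comp hcast
  -- The exponent makes the comparison function `n ^ (-(D + 2))`; the two spare powers of `n` absorb
  -- the linear prefactor and the constant.
  have h1 := hy.eventually
    ((isLittleO_exp_neg_mul_rpow_atTop one_pos (-(D + 2) / υ)).bound one_pos)
  filter_upwards [h1, eventually_gt_atTop 0,
    hcast.eventually_ge_atTop ((|A| + 2) * (4 * Real.exp 1))] with n h1 hn hA
  have hn0 : (0 : ℝ) < n := by exact_mod_cast hn
  have hn1 : (1 : ℝ) ≤ n := by exact_mod_cast hn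
  rw [one_mul, ← Real.rpow_mul hn0.le, mul_div_cancel₀ _ hυ.ne', neg_one_mul,
    Real.norm_of_nonneg (Real.exp_pos _).le, Real.norm_of_nonneg (by positivity)] at h1
  have h2 : (n : ℝ) ^ (-(D + 2)) = (n : ℝ) ^ (-D) * ((n : ℝ) ^ 2)⁻¹ := by
    rw [neg_add, Real.rpow_add hn0, Real.rpow_neg hn0.le 2]
    norm_cast
  have h3 : A * n + 2 ≤ (|A| + 2) * n := by nlinarith [le_abs_self A]
  rw [sub_eq_add_neg, Real.exp_add]
  calc (A * n + 2) * (4 * (Real.exp 1 * Real.exp (-(n : ℝ) ^ υ)))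
      ≤ (|A| + 2) * n * (4 * (Real.exp 1 * Real.exp (-(n : ℝ) ^ υ))) :=
        mul_le_mul_of_nonneg_right h3 (by positivity)
    _ = (|A| + 2) * (4 * Real.exp 1) * n * Real.exp (-(n : ℝ) ^ υ) := by ring
    _ ≤ n * n * ((n : ℝ) ^ (-D) * ((n : ℝ) ^ 2)⁻¹) := by
        rw [← h2]
        gcongr
    _ = _ := by field_simp

theorem eventually_quadratic_rpow_le (A G : ℝ) {υ : ℝ} (hυ : 0 < υ) :
    ∀ᶠ n : ℕ in atTop, A * ((1 + G * ((n : ℝ) ^ (υ / 4) + 2)) * (G * ((n : ℝ) ^ (υ / 4) + 2))) ≤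
      (n : ℝ) ^ υ := by
  have hcast : Tendsto (fun n : ℕ => (n : ℝ)) atTop atTop := tendsto_natCast_atTop_atTop
  have hy : Tendsto (fun n : ℕ => (n : ℝ) ^ (υ / 4)) atTop atTop :=
    (tendsto_rpow_atTop (by positivity)).comp hcast
  -- For `y ≥ 1` one has `y + 2 ≤ 3 y`, so the left side is at most this constant times `y²`, while
  -- the right side is `y⁴`.
  filter_upwards [hy.eventually_ge_atTop (max 1 (|A| * ((1 + 3 * |G|) * (3 * |G|))))] with n hn
  set y := (n : ℝ) ^ (υ / 4) with hy
  have hy1 : 1 ≤ y := (le_max_left _ _).trans hn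
  have hyA := (le_max_right _ _).trans hn
  have hpow : (n : ℝ) ^ υ = y ^ 4 := by
    rw [hy, ← Real.rpow_natCast, ← Real.rpow_mul (Nat.cast_nonneg n)]
    congr 1
    push_cast
    ring
  have hG : |G * (y + 2)| ≤ 3 * |G| * y := by
    rw [abs_mul, abs_of_pos (by linarith : 0 < y + 2)]
    nlinarith [abs_nonneg G]
  have hG1 : |1 + G * (y + 2)| ≤ (1 + 3 * |G|) * y := by
    refine (abs_add_le _ _).trans ?_
    rw [abs_one]
    linarith
  rw [hpow]
  calc A * ((1 + G * (y + 2)) * (G * (y + 2)))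
      ≤ |A| * (((1 + 3 * |G|) * y) * (3 * |G| * y)) := by
        refine (le_abs_self _).trans ?_
        rw [abs_mul, abs_mul]
        gcongr
    _ = |A| * ((1 + 3 * |G|) * (3 * |G|)) * y ^ 2 := by ring
    _ ≤ y * y ^ 2 := by gcongr
    _ ≤ y ^ 4 := by nlinarith [pow_pos (by linarith : 0 < y) 3]

end Asymptotics

/-! ### Assembly: bandwidth conditions, choice of the deviation level, comparison with the rate. -/

theorem mainTheorem2
    -- the latent closed connected Riemannian manifold
    {d : ℕ} {M : Type*} [TopologicalSpace M] [T2Space M] [CompactSpace M] [ConnectedSpace M]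
    [ChartedSpace (EuclideanSpace ℝ (Fin d)) M] [IsManifold (𝓡 d) ∞ M]
    [MeasurableSpace M] [BorelSpace M]
    (g : Bundle.ContMDiffRiemannianMetric (𝓡 d) ∞ (EuclideanSpace ℝ (Fin d))
      (fun x : M => TangentSpace (𝓡 d) x))
    -- the views
    {κ : ℕ} (hκ : 2 ≤ κ) {p : Fin κ → ℕ}
    (ι : ∀ ℓ : Fin κ, M → EuclideanSpace ℝ (Fin (p ℓ)))
    (hι : ∀ ℓ : Fin κ,
      Manifold.IsSmoothEmbedding (𝓡 d) 𝓘(ℝ, EuclideanSpace ℝ (Fin (p ℓ))) ∞ (ι ℓ))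
    -- the latent random vector and its density
    {S : Type*} [MeasurableSpace S] (P : Measure S) [IsProbabilityMeasure P]
    (X : S → M) (hX : Measurable X)
    (ϱ : M → ℝ) (hϱ : Measurable ϱ)
    (hlaw : P.map X = (riemannianVolume g).withDensity fun z => ENNReal.ofReal (ϱ z))
    (δ₀ : ℝ) (hδ₀ : 0 < δ₀) (hδ₀' : δ₀ < 1) (hϱ_bounds : ∀ z : M, δ₀ ≤ ϱ z ∧ ϱ z ≤ δ₀⁻¹)
    -- the i.i.d. sample
    (x : ℕ → S → M) (hx_indep : iIndepFun x P) (hx_ident : ∀ i : ℕ, IdentDistrib (x i) X P P)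
    -- the kernel
    (K : ℝ → ℝ) (hK : IsAdmissibleKernel d K)
    -- the test functions, of class C⁴ on the embedded manifolds
    (f : ∀ j : Fin κ, View ι j → ℝ)
    (hf : ∀ j : Fin κ, ContMDiff (𝓡 d) 𝓘(ℝ, ℝ) 4 (fun z : M => f j (toView ι j z)))
    -- the bandwidths
    (ε : ℕ → Fin κ → ℝ) (hε_pos : ∀ n i, 0 < ε n i)
    (hε_comparable : ∀ i j : Fin κ, (fun n => ε n i) =Θ[atTop] (fun n => ε n j))
    (hε_zero : ∀ i : Fin κ, Tendsto (fun n => ε n i) atTop (𝓝 0))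
    (hε_lower : ∀ i j : Fin κ, i ≠ j →
      Tendsto (fun n : ℕ => Real.sqrt (Real.log n) /
        (Real.sqrt n * ε n i ^ ((d : ℝ) / 4) * ε n j ^ ((d : ℝ) / 4))) atTop (𝓝 0)) :
    StochDominated P (U := fun n => Fin κ × Fin n)
      (fun n s a =>
        |((cleanTransition K (ε n) ι (fun i : Fin n => x i a)).mulVec
            (discretize ι f (fun i : Fin n => x i a))) s -
          limitOperator K (ε n) ι (P.map X) f s.1 (toView ι s.1 (x s.2 a))|)
      (fun n s _ => ∑ j ∈ Finset.univ.erase s.1,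
        1 / (Real.sqrt n * ε n s.1 ^ ((d : ℝ) / 4) * ε n j ^ ((d : ℝ) / 2))) := by

  classical
  have hμ : IsProbabilityMeasure (P.map X) := Measure.isProbabilityMeasure_map hX.aemeasurable
  set μ := P.map X with hμ_def
  have hxm : ∀ i, AEMeasurable (x i) P := fun i => (hx_ident i).aemeasurable_fst
  have hxl : ∀ i, P.map (x i) = μ := fun i => (hx_ident i).map_eq
  have hemb : ∀ j, Topology.IsEmbedding (ι j) := fun j => (hι j).isEmbedding
  have hμlow : ∀ A, MeasurableSet A → ENNReal.ofReal δ₀ * riemannianVolume g A ≤ μ A := by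
    intro A hA
    rw [hlaw, withDensity_apply _ hA, ← setLIntegral_const]
    exact setLIntegral_mono' hA fun z _ => ENNReal.ofReal_le_ofReal (hϱ_bounds z).1
  choose c₁ hc₁ e he hlow using fun j => exists_le_integral_kernelAt hK g hδ₀ hμlow (hι j)
  obtain ⟨c, hc0, hc1, hcj⟩ : ∃ c : ℝ, 0 < c ∧ c ≤ 1 ∧ ∀ j, c ≤ c₁ j := by
    have h : ∀ᶠ c : ℝ in 𝓝[>] 0, 0 < c ∧ c ≤ 1 ∧ ∀ j, c ≤ c₁ j := by
      refine (eventually_mem_nhdsWithin (a := (0 : ℝ)) (s := Set.Ioi 0)).and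
        (((eventually_le_nhds one_pos).filter_mono nhdsWithin_le_nhds).and ?_)
      exact eventually_all.2 fun j => (eventually_le_nhds (hc₁ j)).filter_mono nhdsWithin_le_nhds
    exact h.exists
  set F : Fin κ → M → ℝ := fun j v => f j (toView ι j v) with hF
  have hFm : ∀ j, Measurable (F j) := fun j => (hf j).continuous.measurable
  obtain ⟨C, hC, hFC⟩ : ∃ C : ℝ, 1 ≤ C ∧ ∀ j v, |F j v| ≤ C := by
    have h : ∀ j, ∃ C, ∀ v, |F j v| ≤ C := fun j => by
      obtain ⟨C, hC⟩ := isCompact_univ.exists_bound_of_continuousOn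
        (hf j).continuous.continuousOn
      exact ⟨C, fun v => hC v trivial⟩
    choose C hC using h
    obtain ⟨C', h1, h2⟩ := ((eventually_ge_atTop (1 : ℝ)).and
      (eventually_all.2 fun j => eventually_ge_atTop (C j))).exists
    exact ⟨C', h1, fun j v => (hC j v).trans (h2 j)⟩
  obtain ⟨B, hB, hKB⟩ : ∃ B : ℝ, 1 ≤ B ∧ ∀ r, 0 ≤ r → K r ≤ B := by
    obtain ⟨B, h⟩ := hK.bounded
    exact ⟨max 1 B, le_max_left _ _, fun r hr => (h r hr).trans (le_max_right _ _)⟩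
  have hnontriv : Nontrivial (Fin κ) := Fin.nontrivial_iff_two_le.2 hκ
  intro υ hυ D _
  have hev1 : ∀ᶠ n in atTop, ∀ j, ε n j ≤ e j ∧ ε n j ≤ 1 := eventually_all.2 fun j =>
    ((hε_zero j).eventually (eventually_le_nhds (he j))).and
      ((hε_zero j).eventually (eventually_le_nhds one_pos))
  -- Once `log n ≥ 1`, the bound by `c` gives `c √n t_i t_j ≥ 1`; squared, it says that `n` times
  -- the product of the two kernel lower bounds is at least `1`, as the concentration bounds
  -- require.
  have hev2 : ∀ᶠ n : ℕ in atTop, ∀ i j, i ≠ j → √(Real.log n) /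
      (√n * ε n i ^ ((d : ℝ) / 4) * ε n j ^ ((d : ℝ) / 4)) ≤ c :=
    eventually_all.2 fun i => eventually_all.2 fun j => by
      by_cases hij : i = j
      · simp [hij]
      · filter_upwards [(hε_lower i j hij).eventually (eventually_le_nhds hc0)] with n hn _
        exact hn
  have hev3 : ∀ᶠ n : ℕ in atTop, 1 ≤ Real.log n :=
    (Real.tendsto_log_atTop.comp tendsto_natCast_atTop_atTop).eventually_ge_atTop 1
  obtain ⟨n₀, hn₀⟩ := eventually_atTop.1 (hev1.and (hev2.and (hev3.and
    ((eventually_polynomial_mul_exp_le κ (by positivity : 0 < υ / 4) D).and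
      ((eventually_quadratic_rpow_le ((1 + C) * (2 * c⁻¹)) (C * (κ * B ^ 2)) hυ).and
        (eventually_gt_atTop 0))))))
  refine ⟨n₀, fun n hn => ?_⟩
  obtain ⟨h1, h2, h3, h4, h5, hnpos⟩ := hn₀ n hn
  rintro ⟨ℓ, i⟩
  have hn0 : (0 : ℝ) < n := by exact_mod_cast hnpos
  set k := latentKernel K (ε n) ι with hk
  have hk0 : ∀ j u v, 0 ≤ k j u v := fun j u v =>
    hK.nonneg _ (div_nonneg (sq_nonneg _) (hε_pos n j).le)
  have hkB : ∀ j u v, k j u v ≤ B := fun j u v =>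
    hKB _ (div_nonneg (sq_nonneg _) (hε_pos n j).le)
  have hkm := measurable_latentKernel hK (hε_pos n) hemb
  set t : Fin κ → ℝ := fun j => ε n j ^ ((d : ℝ) / 4) with ht
  have ht0 : ∀ j, 0 < t j := fun j => Real.rpow_pos_of_pos (hε_pos n j) _
  have ht1 : ∀ j, t j ≤ 1 := fun j =>
    Real.rpow_le_one (hε_pos n j).le (h1 j).2 (by positivity)
  have htsq : ∀ j, ε n j ^ ((d : ℝ) / 2) = t j ^ 2 := fun j => by
    rw [ht, ← Real.rpow_natCast, ← Real.rpow_mul (hε_pos n j).le]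
    congr 1
    push_cast
    ring
  have ha : ∀ j, 0 < c * t j ^ 2 := fun j => by have := ht0 j; positivity
  have ha1 : ∀ j, c * t j ^ 2 ≤ 1 := fun j =>
    mul_le_one₀ hc1 (by positivity) (pow_le_one₀ (ht0 j).le (ht1 j))
  have hka : ∀ j w, c * t j ^ 2 ≤ kernelMean μ (k j) 1 w := fun j w => by
    have h := hlow j w (ε n j) (hε_pos n j) (h1 j).1
    rw [htsq] at h
    simp only [kernelMean, Pi.one_apply, mul_one]
    exact (mul_le_mul_of_nonneg_right (hcj j) (by positivity)).trans h
  have hnaa : ∀ j, j ≠ ℓ → 1 ≤ n * (c * t ℓ ^ 2 * (c * t j ^ 2)) := fun j hj => by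
    have hp : 0 < √(n : ℝ) * t ℓ * t j :=
      mul_pos (mul_pos (Real.sqrt_pos.2 hn0) (ht0 ℓ)) (ht0 j)
    have h := (div_le_iff₀ hp).1 (h2 ℓ j hj.symm)
    have h' : 1 ≤ c * (√(n : ℝ) * t ℓ * t j) := (Real.one_le_sqrt.2 h3).trans h
    calc (1 : ℝ) ≤ (c * (√(n : ℝ) * t ℓ * t j)) ^ 2 := one_le_pow₀ h'
      _ = √(n : ℝ) ^ 2 * (c * t ℓ ^ 2 * (c * t j ^ 2)) := by ring
      _ = _ := by rw [Real.sq_sqrt hn0.le]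
  have hna : ∀ j, j ≠ ℓ → 1 ≤ n * (c * t j ^ 2) := fun j hj => by
    refine (hnaa j hj).trans (mul_le_mul_of_nonneg_left ?_ hn0.le)
    exact mul_le_of_le_one_left (ha j).le (ha1 ℓ)
  obtain ⟨j₀, hj₀⟩ := exists_ne ℓ
  -- With `R = n ^ (υ / 4)` the failure probability decays faster than any power of `n`, while `(1 +
  -- ρ) ρ` grows like `n ^ (υ / 2)` and fits under `n ^ υ` with room for constants.
  have hmain := real_ratio_sub_gt_le hx_indep hxm hxl hkm hB hk0 hkB hFm hC hFC ha hka hj₀ hnpos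
    hna (hnaa j₀ hj₀) (R := (n : ℝ) ^ (υ / 4)) (by positivity) i rfl rfl
  refine (measureReal_mono ?_ (measure_ne_top _ _)).trans (hmain.trans h4)
  intro b hb
  rw [Set.mem_ofPred_eq] at hb ⊢
  beta_reduce at hb
  -- The degrees are positive for every sample: the path staying at the sample point contributes `K
  -- 0 * K 0 > 0` through any other view.
  have hpos : ∀ s : Fin κ × Fin n,
      transferSum k 1 s.1 (fun m : Fin n => x m b) (x s.2 b) ≠ 0 := by
    rintro ⟨ℓ', m⟩
    obtain ⟨j, hj⟩ := exists_ne ℓ'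
    have hdiag : ∀ j u, 0 < k j u u := fun j u => by
      simpa [hk, latentKernel, kernelAt] using hK.zero_pos
    have hin0 : ∀ u (l : Fin n) j, 0 ≤ k j u (x l b) * (1 : Fin κ → M → ℝ) j (x l b) :=
      fun u l j => by simpa using hk0 j u (x l b)
    refine (Finset.sum_pos' (fun l _ => mul_nonneg (hk0 _ _ _) (Finset.sum_nonneg fun j _ =>
      Finset.sum_nonneg fun l' _ => hin0 _ l' j)) ⟨m, Finset.mem_univ _, ?_⟩).ne'
    refine mul_pos (hdiag _ _) (Finset.sum_pos' (fun j _ => Finset.sum_nonneg fun l' _ =>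
      hin0 _ l' j) ⟨j, by simp [hj], ?_⟩)
    exact Finset.sum_pos' (fun l' _ => hin0 _ l' j)
      ⟨m, Finset.mem_univ _, by simpa using hdiag j (x m b)⟩
  rw [cleanTransition_mulVec _ _ hpos, limitOperator_toView hK (hε_pos n) hemb hFm hFC] at hb
  refine lt_of_le_of_lt ?_ hb
  set Y := ∑ j ∈ Finset.univ.erase ℓ, 1 / (√(n : ℝ) * t ℓ * t j ^ 2) with hY
  have hYeq : ∑ j ∈ Finset.univ.erase ℓ, 1 / (√(n : ℝ) * ε n ℓ ^ ((d : ℝ) / 4) *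
      ε n j ^ ((d : ℝ) / 2)) = Y := by simp only [htsq, hY, ht]
  have hY0 : ∀ j, 0 ≤ 1 / (√(n : ℝ) * t ℓ * t j ^ 2) := fun j => by
    have := ht0 ℓ
    positivity
  have hsum1 : ∑ j ∈ Finset.univ.erase ℓ, 1 / √(n * (c * t j ^ 2)) ≤ c⁻¹ * Y := by
    rw [hY, Finset.mul_sum]
    exact Finset.sum_le_sum fun j _ =>
      (one_div_sqrt_le hn0 hc0 hc1 (ht0 ℓ) (ht1 ℓ) (ht0 j) (ht1 j)).1
  have hsum2 : 1 / √(n * (c * t ℓ ^ 2 * (c * t j₀ ^ 2))) ≤ c⁻¹ * Y :=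
    ((one_div_sqrt_le hn0 hc0 hc1 (ht0 ℓ) (ht1 ℓ) (ht0 j₀) (ht1 j₀)).2).trans
      (mul_le_mul_of_nonneg_left (Finset.single_le_sum (fun j _ => hY0 j) (by simp [hj₀]))
        (inv_nonneg.2 hc0.le))
  rw [hYeq]
  have hYn : 0 ≤ Y := Finset.sum_nonneg fun j _ => hY0 j
  set ρ := C * (κ * B ^ 2) * ((n : ℝ) ^ (υ / 4) + 2) with hρ
  have hρ0 : 0 ≤ ρ := by positivity
  calc _ ≤ (1 + C) * ((1 + ρ) * ρ * (c⁻¹ * Y + c⁻¹ * Y)) := by gcongr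
    _ = (1 + C) * (2 * c⁻¹) * ((1 + ρ) * ρ) * Y := by ring
    _ ≤ (n : ℝ) ^ υ * Y := mul_le_mul_of_nonneg_right h5 hYn
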